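/- Let $m,\lambda,G>0$ (mass of the field, length scale of the Hadamard parametrix, Newton's constant), $\Lambda,\tau_0\in\mathbb R$, $H_c=\sqrt{180\pi/G}$, and let $(a_0,H_0)$ be initial data with $a_0>0$ and $|H_0|<H_c$. For a continuous function $H$ of conformal time $\tau\ge\tau_0$ put $$a(H)(\tau)=a_0\Big(1-a_0\int_{\tau_0}^{\tau}H(\eta)\,d\eta\Big)^{-1},\qquad V=m^2\big(a(H)^2-a_0^2\big),\qquad k_0=\sqrt{k^2+a_0^2m^2},$$ $$\chi_k^{(0)}(\tau)=\frac{e^{ik_0\tau}}{\sqrt{2k_0}},\qquad \chi_k^{(n)}(\tau)=\int_{\tau_0}^{\tau}\frac{\sin(k_0(\eta-\tau))}{k_0}V(\eta)\,\chi_k^{(n-1)}(\eta)\,d\eta,\qquad \chi_k=\sum_{n\ge0}\chi_k^{(n)},$$ and let, with $a=a(H)$, $k=|\vec k|$ and Euler's constant $\gamma$, $$W(H)(\tau)=\frac{1}{(2\pi)^3a(\tau)^2}\int_{\mathbb R^3}\Big(|\chi_k(\tau)|^2-\frac1{2k_0}+\frac{V(\tau)}{4k_0^3}\Big)d\vec k+\frac{m^2}{(4\pi)^2}\Big(\frac12-\frac{a_0^2}{a(\tau)^2}+2\ln\frac{a_0}{a(\tau)}+2\ln\frac{e^{\gamma}m\lambda}{\sqrt2}\Big)$$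 be the renormalized Wick square of the massive conformally coupled scalar field in the adiabatic state of order zero. The semiclassical Friedmann integral equation is $$H(\tau)=H_0+\int_{\tau_0}^{\tau}f(H)(\eta)\,d\eta,\qquad f(H)=\frac{a(H)}{H_c^2-H^2}\Big(H^4-2H_c^2H^2-\tfrac{15}{2}m^4+240\pi^2\big(m^2W(H)+4\Lambda\big)\Big).$$ A continuous solution $H$ on $[\tau_0,\tau_1]$ is called regular if $\sup_{[\tau_0,\tau_1]}|H|<H_c$ and $a_0\int_{\tau_0}^{\tau}H(\eta)\,d\eta<1$ for every $\tau\in[\tau_0,\tau_1]$. A solution on $[\tau_0,T)$, $\tau_0<T\le\infty$, is called regular if it is regular on every interval $[\tau_0,\tau_1]\subset[\tau_0,T)$; a regular solution is called maximal if it is not the restriction of a regular solution on a strictly larger interval $[\tau_0,T')$. Then there is exactly one maximal regular solution $H$, on an interval $[\tau_0,T)$, and every regular solution on an interval $[\tau_0,T')$ is a restriction of it, i.e. $T'\le T$ and the solution equals $H$ on $[\tau_0,T')$. Along $H$ the series and integrals above converge: for every $\tau\in[\tau_0,T)$ the series for $\chi_k(\tau)$ and the integral over $\vec k$ converge absolutely,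 and $f(H)$ is integrable on $[\tau_0,\tau]$. Moreover, either $T=\infty$, or $T<\infty$ and $H(\tau)^2\to H_c^2$ or $a(H)(\tau)\to\infty$ as $\tau\to T^-$. -/

import Mathlib

open Real Set Filter Topology MeasureTheory

noncomputable section

/-- The constants of the problem: field mass `m`, length scale `ℓ` of the Hadamard parametrix,
Newton's constant `G`, cosmological constant `Lam`, initial conformal time `τ₀`, initial scale
factor `a₀` and initial Hubble rate `H₀`. -/
structure FriedmannData where
  m : ℝ
  ℓ : ℝ
  G : ℝ
  Lam : ℝ
  τ₀ : ℝ
  a₀ : ℝ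
  H₀ : ℝ

namespace FriedmannData

/-- The critical Hubble rate, `H_c ^ 2 = 180 π / G`. -/
def Hc (p : FriedmannData) : ℝ := √(180 * π / p.G)

/-- The scale factor determined by a Hubble function `H` (in conformal time):
`a(H)(τ) = a₀ (1 - a₀ ∫_{τ₀}^τ H)⁻¹`, the solution of `a' = a ^ 2 H`, `a(τ₀) = a₀`. -/
def scaleFactor (p : FriedmannData) (H : ℝ → ℝ) (τ : ℝ) : ℝ :=
  p.a₀ * (1 - p.a₀ * ∫ η in p.τ₀..τ, H η)⁻¹

/-- The potential `V = m ^ 2 (a ^ 2 - a₀ ^ 2)`. -/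
def potential (p : FriedmannData) (H : ℝ → ℝ) (τ : ℝ) : ℝ :=
  p.m ^ 2 * (p.scaleFactor H τ ^ 2 - p.a₀ ^ 2)

/-- The initial frequency `k₀ = (k ^ 2 + a₀ ^ 2 m ^ 2) ^ (1/2)`. -/
def freq (p : FriedmannData) (k : ℝ) : ℝ := √(k ^ 2 + p.a₀ ^ 2 * p.m ^ 2)

/-- The partial modes `χ_k⁽ⁿ⁾` of the adiabatic state of order zero. -/
def partialMode (p : FriedmannData) (H : ℝ → ℝ) (k : ℝ) : ℕ → ℝ → ℂ
  | 0 => fun τ =>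
      ((1 / √(2 * p.freq k) : ℝ) : ℂ) * Complex.exp (Complex.I * ((p.freq k * τ : ℝ) : ℂ))
  | n + 1 => fun τ => ∫ η in p.τ₀..τ,
      ((sin (p.freq k * (η - τ)) / p.freq k * p.potential H η : ℝ) : ℂ) *
        partialMode p H k n η

/-- The mode `χ_k = ∑ₙ χ_k⁽ⁿ⁾`. -/
def mode (p : FriedmannData) (H : ℝ → ℝ) (k τ : ℝ) : ℂ := ∑' n, p.partialMode H k n τ

/-- The regularized mode density `|χ_k| ^ 2 - 1 / (2 k₀) + V / (4 k₀ ^ 3)` at time `τ`,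
as a function of the momentum in `ℝ ^ 3`. -/
def wickIntegrand (p : FriedmannData) (H : ℝ → ℝ) (τ : ℝ) (k : EuclideanSpace ℝ (Fin 3)) : ℝ :=
  ‖p.mode H ‖k‖ τ‖ ^ 2 - 1 / (2 * p.freq ‖k‖) + p.potential H τ / (4 * p.freq ‖k‖ ^ 3)

/-- The renormalized Wick square `ω(:φ ^ 2:)(H)(τ)` in the adiabatic state of order zero. -/
def wickSquare (p : FriedmannData) (H : ℝ → ℝ) (τ : ℝ) : ℝ :=
  1 / ((2 * π) ^ 3 * p.scaleFactor H τ ^ 2) * (∫ k, p.wickIntegrand H τ k) +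
    p.m ^ 2 / (4 * π) ^ 2 *
      (1 / 2 - (p.a₀ / p.scaleFactor H τ) ^ 2 + 2 * log (p.a₀ / p.scaleFactor H τ) +
        2 * log (exp eulerMascheroniConstant * p.m * p.ℓ / √2))

/-- The integrand `f(H)` of the semiclassical Friedmann integral equation. -/
def rhs (p : FriedmannData) (H : ℝ → ℝ) (τ : ℝ) : ℝ :=
  p.scaleFactor H τ / (p.Hc ^ 2 - H τ ^ 2) *
    (H τ ^ 4 - 2 * p.Hc ^ 2 * H τ ^ 2 - 15 / 2 * p.m ^ 4 +
      240 * π ^ 2 * (p.m ^ 2 * p.wickSquare H τ + 4 * p.Lam))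

/-- `H` is a continuous, regular solution on the closed interval `[τ₀, τ₁]` of the integral
equation `H(τ) = H₀ + ∫_{τ₀}^τ f(H)(η) dη`. On a compact interval the pointwise bound
`|H| < H_c` is the same as the bound on the uniform norm. -/
structure IsRegularOn (p : FriedmannData) (H : ℝ → ℝ) (τ₁ : ℝ) : Prop where
  continuousOn : ContinuousOn H (Icc p.τ₀ τ₁)
  equation : ∀ τ ∈ Icc p.τ₀ τ₁, H τ = p.H₀ + ∫ η in p.τ₀..τ, p.rhs H η
  abs_lt : ∀ τ ∈ Icc p.τ₀ τ₁, |H τ| < p.Hc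
  integral_lt : ∀ τ ∈ Icc p.τ₀ τ₁, p.a₀ * (∫ η in p.τ₀..τ, H η) < 1

/-- The half-open interval `[τ₀, T)`, where `T = ∞` is allowed. -/
def interval (p : FriedmannData) (T : EReal) : Set ℝ := {τ | p.τ₀ ≤ τ ∧ (τ : EReal) < T}

/-- `H` is a regular solution on the nonempty interval `[τ₀, T)`: it is one on every closed
interval `[τ₀, τ₁]` contained in it. (Values of `H` outside `[τ₀, T)` play no role.) -/
def IsRegularSolution (p : FriedmannData) (T : EReal) (H : ℝ → ℝ) : Prop :=
  (p.τ₀ : EReal) < T ∧ ∀ τ₁ ∈ p.interval T, p.IsRegularOn H τ₁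

/-- A regular solution is maximal if it is not the restriction of a regular solution on a
strictly larger interval. -/
def IsMaximalSolution (p : FriedmannData) (T : EReal) (H : ℝ → ℝ) : Prop :=
  p.IsRegularSolution T H ∧
    ∀ (T' : EReal) (H' : ℝ → ℝ), p.IsRegularSolution T' H' → T ≤ T' →
      EqOn H' H (p.interval T) → T' = T

/-- All series and integrals in the integral equation for `H` at time `τ` converge. -/
structure ConvergesAt (p : FriedmannData) (H : ℝ → ℝ) (τ : ℝ) : Prop where
  summable_mode : ∀ k : ℝ, Summable fun n => p.partialMode H k n τ
  integrable_wick : Integrable (p.wickIntegrand H τ)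
  integrable_rhs : IntervalIntegrable (p.rhs H) volume p.τ₀ τ

end FriedmannData

end

/-! The difficulty is that the Wick square W(H) is a nonlocal functional of H whose momentum
integral converges only after subtractions. Once W is known to be Lipschitz in the uniform norm of
H, the rest is Volterra theory: a causal Lipschitz integral equation has unique solutions, and they
continue until they reach the boundary of the domain.

The Lipschitz bound. Put κ = k₀, v = V' and z = |χ|² - 1/(2κ). The energy |χ'|² + (κ² + V)|χ|² has
derivative v|χ|², which turns the mode equation into z'' + 4κ²z = -V/κ + 2∫vz - 4Vz with vanishing
initial data. Duhamel's formula and an integration by parts give z + V/(4κ³) = c(κ)/(4κ³) + R, where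
c is a finite cosine transform of v (`modeDeviation_eq`). Gronwall's inequality gives z = O(κ⁻³),
hence R = O(κ⁻⁴), which is integrable over ℝ³; differences are treated alike. The weight κ⁻³ alone
diverges logarithmically, but c is square integrable by an estimate of Plancherel type
(`cosTransform_sq_integrable`), and this suffices. All constants involve only sup |v|, and v =
2m²a³H contains no derivative of H, so no regularity is lost (`exists_abs_wickIntegral_sub_le`).

Solving. Truncate H at a level b < H_c and a₀/a at a level δ > 0. On compact time intervals f
becomes bounded, causal and globally Lipschitz (`exists_isCausalLipschitz_cutRhs`), and some iterate
of the Picard operator is a contraction. A regular solution on a compact interval solves one of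
these truncated equations; this gives uniqueness and extension, and gluing gives the greatest
solution.

The alternative at finite T. Since |H| < H_c, the quotient a₀/a is continuous up to T. Either it
tends to 0, so that a → ∞, or it is at least some δ > 0. In the second case W is bounded up to T,
and only the factor 1/(H_c² - H²) can make f large. If H² did not tend to H_c², there would be times
s → T with |H(s)| away from H_c, and the bounded slope would leave no time to approach H_c after s.
Then |H| ≤ b < H_c up to T, and a truncated solution continues H to T and beyond, a contradiction.
-/

noncomputable section

/-! ### The Dyson series and its differential equation -/

/-- The terms of the Dyson series of `χ'' + (κ ^ 2 + V) χ = 0` with initial values of a positive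
frequency plane wave at `t₀`. -/
def dysonTerm (t₀ κ : ℝ) (V : ℝ → ℝ) : ℕ → ℝ → ℂ
  | 0 => fun τ => ((1 / √(2 * κ) : ℝ) : ℂ) * Complex.exp (Complex.I * ((κ * τ : ℝ) : ℂ))
  | n + 1 => fun τ => ∫ η in t₀..τ,
      ((sin (κ * (η - τ)) / κ * V η : ℝ) : ℂ) * dysonTerm t₀ κ V n η

/-- The sum of the Dyson series. -/
def dysonSum (t₀ κ : ℝ) (V : ℝ → ℝ) (τ : ℝ) : ℂ := ∑' n, dysonTerm t₀ κ V n τ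

theorem dysonTerm_congr {t₀ t₁ κ : ℝ} {V V' : ℝ → ℝ} (h : EqOn V V' (Icc t₀ t₁)) (n : ℕ) :
    EqOn (dysonTerm t₀ κ V n) (dysonTerm t₀ κ V' n) (Icc t₀ t₁) := by
  induction n with
  | zero => intro τ _; rfl
  | succ n ih =>
    intro τ hτ
    simp only [dysonTerm]
    refine intervalIntegral.integral_congr fun η hη => ?_
    rw [uIcc_of_le hτ.1] at hη
    have hη' : η ∈ Icc t₀ t₁ := ⟨hη.1, hη.2.trans hτ.2⟩
    simp only [h hη', ih hη']

theorem continuous_dysonTerm {X : Type*} [TopologicalSpace X] {ω : X → ℝ} (hω : Continuous ω)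
    (hpos : ∀ x, 0 < ω x) (t₀ : ℝ) {V : ℝ → ℝ} (hV : Continuous V) (n : ℕ) :
    Continuous fun q : X × ℝ => dysonTerm t₀ (ω q.1) V n q.2 := by
  induction n with
  | zero =>
    simp only [dysonTerm]
    have h : ∀ q : X × ℝ, √(2 * ω q.1) ≠ 0 := fun q =>
      (Real.sqrt_pos.2 (by have := hpos q.1; positivity)).ne'
    refine Continuous.mul (Complex.continuous_ofReal.comp ?_) (by fun_prop)
    exact continuous_const.div (by fun_prop) h
  | succ n ih =>
    simp only [dysonTerm]
    refine intervalIntegral.continuous_parametric_intervalIntegral_of_continuous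
      (f := fun (q : X × ℝ) η => ((sin (ω q.1 * (η - q.2)) / ω q.1 * V η : ℝ) : ℂ) *
        dysonTerm t₀ (ω q.1) V n η) ?_ continuous_snd
    refine Continuous.mul (Complex.continuous_ofReal.comp ?_)
      (ih.comp (by fun_prop : Continuous fun p : (X × ℝ) × ℝ => (p.1.1, p.2)))
    refine Continuous.mul (Continuous.div (by fun_prop) (by fun_prop) fun q => (hpos _).ne')
      (by fun_prop)

theorem continuous_dysonTerm_time {κ : ℝ} (hκ : 0 < κ) (t₀ : ℝ) {V : ℝ → ℝ} (hV : Continuous V)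
    (n : ℕ) : Continuous (dysonTerm t₀ κ V n) :=
  (continuous_dysonTerm (X := Unit) (ω := fun _ => κ) continuous_const (fun _ => hκ) t₀ hV n).comp
    (Continuous.prodMk_right ())

/-- Each iteration contributes a factor `B / κ` and one integration in time. The bound is two-sided
in `τ - t₀` because the modes are treated on the whole line, which makes all later derivatives
ordinary ones. -/
theorem norm_dysonTerm_le {κ : ℝ} (hκ : 0 < κ) {t₀ R B : ℝ} {V : ℝ → ℝ}
    (hB : ∀ τ, |τ - t₀| ≤ R → |V τ| ≤ B) (n : ℕ) {τ : ℝ} (hτ : |τ - t₀| ≤ R) :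
    ‖dysonTerm t₀ κ V n τ‖ ≤ 1 / √(2 * κ) * ((B / κ * |τ - t₀|) ^ n / n.factorial) := by
  have hR : 0 ≤ R := (abs_nonneg _).trans hτ
  have hB0 : 0 ≤ B := (abs_nonneg _).trans (hB t₀ (by simpa using hR))
  induction n generalizing τ with
  | zero =>
    simp only [dysonTerm, norm_mul, Complex.norm_real]
    rw [mul_comm Complex.I, Complex.norm_exp_ofReal_mul_I, Real.norm_of_nonneg (by positivity)]
    simp
  | succ n ih =>
    simp only [dysonTerm]
    have key : ∀ η ∈ uIoc t₀ τ, ‖((sin (κ * (η - τ)) / κ * V η : ℝ) : ℂ) * dysonTerm t₀ κ V n η‖ ≤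
        1 / √(2 * κ) * ((B / κ) ^ (n + 1) / n.factorial) * |η - t₀| ^ n := by
      intro η hη
      have hη' : |η - t₀| ≤ |τ - t₀| := by
        rcases le_total t₀ τ with h | h
        · rw [uIoc_of_le h] at hη
          rw [abs_of_nonneg (by linarith [hη.1]), abs_of_nonneg (by linarith)]
          linarith [hη.2]
        · rw [uIoc_of_ge h] at hη
          rw [abs_of_nonpos (by linarith [hη.2]), abs_of_nonpos (by linarith)]
          linarith [hη.1]
      have h1 := ih (hη'.trans hτ)
      have h2 := hB η (hη'.trans hτ)
      rw [norm_mul, Complex.norm_real, Real.norm_eq_abs, abs_mul, abs_div, abs_of_pos hκ]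
      calc |sin (κ * (η - τ))| / κ * |V η| * ‖dysonTerm t₀ κ V n η‖
          ≤ 1 / κ * B * (1 / √(2 * κ) * ((B / κ * |η - t₀|) ^ n / n.factorial)) := by
            gcongr; exact abs_sin_le_one _
        _ = _ := by rw [mul_pow, pow_succ (B / κ)]; ring
    calc _ ≤ ∫ η in uIoc t₀ τ, 1 / √(2 * κ) * ((B / κ) ^ (n + 1) / n.factorial) * |η - t₀| ^ n := by
          rw [intervalIntegral.norm_intervalIntegral_eq]
          refine norm_integral_le_of_norm_le ?_ ((ae_restrict_iff' measurableSet_uIoc).2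
            (.of_forall key))
          exact (Continuous.intervalIntegrable (by fun_prop) _ _).def'
      _ = _ := by
          rw [integral_const_mul, integral_pow_abs_sub_uIoc, Nat.factorial_succ, mul_pow]
          push_cast
          field_simp

theorem exists_bound_of_continuous {V : ℝ → ℝ} (hV : Continuous V) (t₀ R : ℝ) :
    ∃ B, ∀ τ, |τ - t₀| ≤ R → |V τ| ≤ B := by
  obtain ⟨B, hB⟩ := (isCompact_Icc (a := t₀ - R) (b := t₀ + R)).exists_bound_of_continuousOn
    hV.continuousOn
  exact ⟨B, fun τ hτ => hB τ ⟨by linarith [(abs_le.1 hτ).1], by linarith [(abs_le.1 hτ).2]⟩⟩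

theorem exists_summable_bound_dysonTerm {κ : ℝ} (hκ : 0 < κ) {t₀ : ℝ} {V : ℝ → ℝ}
    (hV : Continuous V) (R : ℝ) :
    ∃ u : ℕ → ℝ, Summable u ∧ ∀ n τ, |τ - t₀| ≤ R → ‖dysonTerm t₀ κ V n τ‖ ≤ u n := by
  obtain ⟨B, hB⟩ := exists_bound_of_continuous hV t₀ R
  refine ⟨fun n => 1 / √(2 * κ) * ((B / κ * R) ^ n / n.factorial),
    (Real.summable_pow_div_factorial _).mul_left _, fun n τ hτ => ?_⟩
  refine (norm_dysonTerm_le hκ hB n hτ).trans ?_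
  have hR : 0 ≤ R := (abs_nonneg _).trans hτ
  have hB0 : 0 ≤ B := (abs_nonneg _).trans (hB t₀ (by simpa using hR))
  change _ ≤ 1 / √(2 * κ) * ((B / κ * R) ^ n / n.factorial)
  gcongr

theorem summable_dysonTerm {κ : ℝ} (hκ : 0 < κ) (t₀ : ℝ) {V : ℝ → ℝ} (hV : Continuous V) (τ : ℝ) :
    Summable fun n => dysonTerm t₀ κ V n τ := by
  obtain ⟨u, hu, h⟩ := exists_summable_bound_dysonTerm hκ (t₀ := t₀) hV |τ - t₀|
  exact Summable.of_norm_bounded hu fun n => h n τ le_rfl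

theorem continuous_dysonSum {κ : ℝ} (hκ : 0 < κ) (t₀ : ℝ) {V : ℝ → ℝ} (hV : Continuous V) :
    Continuous (dysonSum t₀ κ V) := by
  rw [continuous_iff_continuousAt]
  intro τ
  obtain ⟨u, hu, h⟩ := exists_summable_bound_dysonTerm hκ (t₀ := t₀) hV (|τ - t₀| + 1)
  have hc : ContinuousOn (dysonSum t₀ κ V) (Metric.ball τ 1) := by
    refine continuousOn_tsum (fun n => (continuous_dysonTerm_time hκ t₀ hV n).continuousOn) hu
      fun n x hx => h n x ?_
    have h1 : |x - τ| < 1 := hx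
    linarith [abs_sub_le x τ t₀]
  exact hc.continuousAt (Metric.ball_mem_nhds _ one_pos)

theorem dysonSum_eq {κ : ℝ} (hκ : 0 < κ) (t₀ : ℝ) {V : ℝ → ℝ} (hV : Continuous V) (τ : ℝ) :
    dysonSum t₀ κ V τ = dysonTerm t₀ κ V 0 τ +
      ∫ η in t₀..τ, ((sin (κ * (η - τ)) / κ * V η : ℝ) : ℂ) * dysonSum t₀ κ V η := by
  unfold dysonSum
  rw [(summable_dysonTerm hκ t₀ hV τ).tsum_eq_zero_add]
  congr 1
  obtain ⟨u, hu, h⟩ := exists_summable_bound_dysonTerm hκ (t₀ := t₀) hV |τ - t₀|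
  obtain ⟨B, hB⟩ := exists_bound_of_continuous hV t₀ |τ - t₀|
  have hB0 : 0 ≤ B := (abs_nonneg _).trans (hB τ le_rfl)
  refine HasSum.tsum_eq (intervalIntegral.hasSum_integral_of_dominated_convergence
    (F := fun n η => ((sin (κ * (η - τ)) / κ * V η : ℝ) : ℂ) * dysonTerm t₀ κ V n η)
    (fun n _ => 1 / κ * B * u n) (fun n => ?_) (fun n => .of_forall fun η hη => ?_)
    (.of_forall fun _ _ => hu.mul_left _) (by simp) (.of_forall fun η _ => ?_))
  · refine Continuous.aestronglyMeasurable ?_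
    exact (Complex.continuous_ofReal.comp (by fun_prop)).mul (continuous_dysonTerm_time hκ t₀ hV n)
  · have hη' : |η - t₀| ≤ |τ - t₀| := by
      have := uIoc_subset_uIcc hη
      exact abs_sub_left_of_mem_uIcc this
    rw [norm_mul, Complex.norm_real, Real.norm_eq_abs, abs_mul, abs_div, abs_of_pos hκ]
    gcongr
    · exact abs_sin_le_one _
    · exact hB η hη'
    · exact h n η hη'
  · exact (summable_dysonTerm hκ t₀ hV η).hasSum.mul_left _

/-- The addition theorem splits the kernel sin (κ (η - τ)) into products of functions of η and of τ.
The integral equation then expresses χ through the primitives `A` and `B`, and both derivatives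
follow from the product rule. -/
theorem dysonSum_hasDerivAt {κ : ℝ} (hκ : 0 < κ) (t₀ : ℝ) {V : ℝ → ℝ} (hV : Continuous V) :
    ∃ P : ℝ → ℂ, (∀ τ, HasDerivAt (dysonSum t₀ κ V) (P τ) τ) ∧
      (∀ τ, HasDerivAt P (-(((κ ^ 2 + V τ : ℝ) : ℂ) * dysonSum t₀ κ V τ)) τ) ∧
      ‖dysonSum t₀ κ V t₀‖ ^ 2 = 1 / (2 * κ) ∧ P t₀ = Complex.I * κ * dysonSum t₀ κ V t₀ := by
  set χ := dysonSum t₀ κ V with hχ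
  have hχc : Continuous χ := continuous_dysonSum hκ t₀ hV
  set w : ℂ := ((1 / √(2 * κ) : ℝ) : ℂ) with hw
  set A : ℝ → ℂ := fun τ => ∫ η in t₀..τ, ((sin (κ * η) * V η : ℝ) : ℂ) * χ η with hA
  set B : ℝ → ℂ := fun τ => ∫ η in t₀..τ, ((cos (κ * η) * V η : ℝ) : ℂ) * χ η with hB
  have hAc : Continuous fun η => ((sin (κ * η) * V η : ℝ) : ℂ) * χ η :=
    (Complex.continuous_ofReal.comp (by fun_prop)).mul hχc
  have hBc : Continuous fun η => ((cos (κ * η) * V η : ℝ) : ℂ) * χ η :=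
    (Complex.continuous_ofReal.comp (by fun_prop)).mul hχc
  have hA' : ∀ τ, HasDerivAt A (((sin (κ * τ) * V τ : ℝ) : ℂ) * χ τ) τ := fun τ =>
    hAc.integral_hasStrictDerivAt t₀ τ |>.hasDerivAt
  have hB' : ∀ τ, HasDerivAt B (((cos (κ * τ) * V τ : ℝ) : ℂ) * χ τ) τ := fun τ =>
    hBc.integral_hasStrictDerivAt t₀ τ |>.hasDerivAt
  have hκ' : (κ : ℂ) ≠ 0 := by exact_mod_cast hκ.ne'
  have hrep : ∀ τ, χ τ = w * Complex.exp (Complex.I * (κ * τ : ℝ)) +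
      (((cos (κ * τ) : ℝ) : ℂ) * A τ - ((sin (κ * τ) : ℝ) : ℂ) * B τ) / κ := by
    intro τ
    rw [hχ, dysonSum_eq hκ t₀ hV τ]
    congr 1
    rw [hA, hB]
    simp only
    rw [← intervalIntegral.integral_const_mul, ← intervalIntegral.integral_const_mul,
      ← intervalIntegral.integral_sub ((hAc.const_mul _).intervalIntegrable _ _)
        ((hBc.const_mul _).intervalIntegrable _ _), ← intervalIntegral.integral_div]
    refine intervalIntegral.integral_congr fun η _ => ?_
    simp only [← hχ]
    rw [mul_sub, Real.sin_sub]
    push_cast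
    field_simp
  have hs : ∀ τ : ℝ, HasDerivAt (fun τ : ℝ => ((sin (κ * τ) : ℝ) : ℂ))
      (((cos (κ * τ) * κ : ℝ) : ℂ)) τ := fun τ => by
    have := ((hasDerivAt_id τ).const_mul κ).sin
    simp only [id, mul_one] at this
    exact this.ofReal_comp
  have hc : ∀ τ : ℝ, HasDerivAt (fun τ : ℝ => ((cos (κ * τ) : ℝ) : ℂ))
      (((-sin (κ * τ) * κ : ℝ) : ℂ)) τ := fun τ => by
    have := ((hasDerivAt_id τ).const_mul κ).cos
    simp only [id, mul_one] at this
    exact this.ofReal_comp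
  have he : ∀ τ : ℝ, HasDerivAt (fun τ : ℝ => Complex.exp (Complex.I * (κ * τ : ℝ)))
      (Complex.exp (Complex.I * (κ * τ : ℝ)) * (Complex.I * κ)) τ := fun τ => by
    have := ((hasDerivAt_id τ).const_mul κ).ofReal_comp.const_mul Complex.I
    simp only [id, mul_one] at this
    exact this.cexp
  refine ⟨fun τ => w * (Complex.exp (Complex.I * (κ * τ : ℝ)) * (Complex.I * κ)) -
      (((sin (κ * τ) : ℝ) : ℂ) * A τ + ((cos (κ * τ) : ℝ) : ℂ) * B τ), fun τ => ?_, fun τ => ?_,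
      ?_, ?_⟩
  · rw [funext hrep]
    refine (((he τ).const_mul w).add ((((hc τ).mul (hA' τ)).sub ((hs τ).mul (hB' τ))).div_const
      (κ : ℂ))).congr_deriv ?_
    push_cast
    field_simp
    ring
  · refine ((((he τ).mul_const (Complex.I * κ)).const_mul w).sub
      (((hs τ).mul (hA' τ)).add ((hc τ).mul (hB' τ)))).congr_deriv ?_
    have h1 : ((sin (κ * τ) : ℝ) : ℂ) ^ 2 + ((cos (κ * τ) : ℝ) : ℂ) ^ 2 = 1 := by
      exact_mod_cast Real.sin_sq_add_cos_sq _
    have h2 := hrep τ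
    have h3 : (κ : ℂ) * χ τ = w * κ * Complex.exp (Complex.I * (κ * τ : ℝ)) +
      (((cos (κ * τ) : ℝ) : ℂ) * A τ - ((sin (κ * τ) : ℝ) : ℂ) * B τ) := by
      rw [h2]; field_simp
    push_cast at h1 h3 ⊢
    linear_combination (κ : ℂ) * h3 - V τ * χ τ * h1 + w * κ ^ 2 *
      Complex.exp (Complex.I * (κ * τ)) * Complex.I_sq
  · have : χ t₀ = w * Complex.exp ((κ * t₀ : ℝ) * Complex.I) := by
      rw [hrep, hA, hB]; simp [mul_comm]
    rw [this, norm_mul, Complex.norm_exp_ofReal_mul_I, hw, Complex.norm_real, mul_one,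
      Real.norm_of_nonneg (by positivity), div_pow, Real.sq_sqrt (by positivity), one_pow]
  · rw [hrep t₀, hA, hB]
    simp
    ring

/-! ### The deviation of |χ|² from its vacuum value -/

/-- The primitive of `v` that vanishes at `t₀`. -/
def primitive (t₀ : ℝ) (v : ℝ → ℝ) (τ : ℝ) : ℝ := ∫ η in t₀..τ, v η

theorem hasDerivAt_primitive (t₀ : ℝ) {v : ℝ → ℝ} (hv : Continuous v) (τ : ℝ) :
    HasDerivAt (primitive t₀ v) (v τ) τ := (hv.integral_hasStrictDerivAt t₀ τ).hasDerivAt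

theorem continuous_primitive (t₀ : ℝ) {v : ℝ → ℝ} (hv : Continuous v) :
    Continuous (primitive t₀ v) :=
  continuous_iff_continuousAt.2 fun τ => (hasDerivAt_primitive t₀ hv τ).continuousAt

@[simp] theorem primitive_self (t₀ : ℝ) (v : ℝ → ℝ) : primitive t₀ v t₀ = 0 := by simp [primitive]

theorem abs_primitive_le {t₀ τ D : ℝ} {v : ℝ → ℝ} (h : t₀ ≤ τ) (hv : ∀ η ∈ Icc t₀ τ, |v η| ≤ D) :
    |primitive t₀ v τ| ≤ D * (τ - t₀) := by
  have := intervalIntegral.norm_integral_le_of_norm_le_const (a := t₀) (b := τ) (f := v) (C := D)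
    fun η hη => hv η (by rw [uIoc_of_le h] at hη; exact Ioc_subset_Icc_self hη)
  rwa [abs_of_nonneg (sub_nonneg.2 h)] at this

theorem primitive_sub (t₀ : ℝ) {v w : ℝ → ℝ} (hv : Continuous v) (hw : Continuous w) (τ : ℝ) :
    primitive t₀ (fun η => v η - w η) τ = primitive t₀ v τ - primitive t₀ w τ :=
  intervalIntegral.integral_sub (hv.intervalIntegrable _ _) (hw.intervalIntegrable _ _)

/-- The deviation of `|χ| ^ 2` from its vacuum value, for the potential with derivative `v`. -/
def modeDeviation (t₀ κ : ℝ) (v : ℝ → ℝ) (τ : ℝ) : ℝ :=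
  ‖dysonSum t₀ κ (primitive t₀ v) τ‖ ^ 2 - 1 / (2 * κ)

/-- The finite cosine transform of `v`. -/
def cosTransform (t₀ : ℝ) (v : ℝ → ℝ) (τ κ : ℝ) : ℝ := ∫ η in t₀..τ, cos (2 * κ * (τ - η)) * v η

/-- The part of the mode deviation of higher than first order in the potential. -/
def modeRemainder (t₀ κ : ℝ) (v : ℝ → ℝ) (τ : ℝ) : ℝ :=
  ∫ η in t₀..τ, sin (2 * κ * (τ - η)) / (2 * κ) *
    (2 * primitive t₀ (fun ζ => v ζ * modeDeviation t₀ κ v ζ) η -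
      4 * primitive t₀ v η * modeDeviation t₀ κ v η)

theorem continuous_modeDeviation {κ : ℝ} (hκ : 0 < κ) (t₀ : ℝ) {v : ℝ → ℝ} (hv : Continuous v) :
    Continuous (modeDeviation t₀ κ v) :=
  ((continuous_dysonSum hκ t₀ (continuous_primitive t₀ hv)).norm.pow 2).sub continuous_const

/-- With y = |χ|² and the energy E = |χ'|² + (κ² + V) y, the mode equation gives y'' = 2E - 4(κ² +
V) y. Since E' = v y contains no χ', integrating it leaves a closed equation for y. -/
theorem modeDeviation_hasDerivAt {κ : ℝ} (hκ : 0 < κ) (t₀ : ℝ) {v : ℝ → ℝ} (hv : Continuous v) :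
    modeDeviation t₀ κ v t₀ = 0 ∧ ∃ z' : ℝ → ℝ, z' t₀ = 0 ∧
      (∀ τ, HasDerivAt (modeDeviation t₀ κ v) (z' τ) τ) ∧
      ∀ τ, HasDerivAt z' (-primitive t₀ v τ / κ +
        (2 * primitive t₀ (fun ζ => v ζ * modeDeviation t₀ κ v ζ) τ -
          4 * primitive t₀ v τ * modeDeviation t₀ κ v τ) -
        4 * κ ^ 2 * modeDeviation t₀ κ v τ) τ := by
  have hV := continuous_primitive t₀ hv
  obtain ⟨P, hχ, hP, h0, hP0⟩ := dysonSum_hasDerivAt hκ t₀ hV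
  set χ := dysonSum t₀ κ (primitive t₀ v) with hχdef
  have hz := continuous_modeDeviation hκ t₀ hv
  have hzτ : ∀ τ, ‖χ τ‖ ^ 2 = modeDeviation t₀ κ v τ + 1 / (2 * κ) := fun τ => by
    simp [modeDeviation, hχdef]
  have hy' : ∀ τ, HasDerivAt (fun τ => ‖χ τ‖ ^ 2) (2 * inner ℝ (χ τ) (P τ)) τ := fun τ =>
    (hχ τ).norm_sq
  set E : ℝ → ℝ := fun τ => ‖P τ‖ ^ 2 + (κ ^ 2 + primitive t₀ v τ) * ‖χ τ‖ ^ 2 with hE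
  have hinner : ∀ τ, inner ℝ (P τ) (-(((κ ^ 2 + primitive t₀ v τ : ℝ) : ℂ) * χ τ)) =
      -(κ ^ 2 + primitive t₀ v τ) * inner ℝ (χ τ) (P τ) := fun τ => by
    rw [← Complex.real_smul, inner_neg_right, inner_smul_right, real_inner_comm]; ring
  have hE' : ∀ τ, HasDerivAt E (v τ * ‖χ τ‖ ^ 2) τ := fun τ => by
    have h1 := (hP τ).norm_sq
    rw [hinner] at h1
    refine (h1.add (((hasDerivAt_primitive t₀ hv τ).const_add (κ ^ 2)).mul (hy' τ))).congr_deriv ?_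
    ring
  have hE0 : E t₀ = κ := by
    simp only [hE, hP0, primitive_self, norm_mul, Complex.norm_I, Complex.norm_real, mul_pow, h0]
    rw [Real.norm_of_nonneg hκ.le]
    field_simp
    ring
  have hEeq : ∀ τ, E τ = κ + primitive t₀ v τ / (2 * κ) +
      primitive t₀ (fun ζ => v ζ * modeDeviation t₀ κ v ζ) τ := by
    intro τ
    have hc : Continuous fun η => v η * ‖χ η‖ ^ 2 :=
      hv.mul ((continuous_dysonSum hκ t₀ hV).norm.pow 2)
    have h1 := intervalIntegral.integral_eq_sub_of_hasDerivAt (a := t₀) (b := τ)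
      (fun η _ => hE' η) (hc.intervalIntegrable _ _)
    rw [hE0] at h1
    have h2 : ∫ η in t₀..τ, v η * ‖χ η‖ ^ 2 = primitive t₀ v τ / (2 * κ) +
        primitive t₀ (fun ζ => v ζ * modeDeviation t₀ κ v ζ) τ := by
      have hvz : Continuous fun ζ => v ζ * modeDeviation t₀ κ v ζ := hv.mul hz
      unfold primitive
      rw [← intervalIntegral.integral_div, ← intervalIntegral.integral_add
        ((hv.div_const _).intervalIntegrable _ _) (hvz.intervalIntegrable _ _)]
      refine intervalIntegral.integral_congr fun η _ => ?_
      simp only [hzτ]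
      ring
    linarith
  refine ⟨by rw [modeDeviation, ← hχdef, h0, sub_self], fun τ => 2 * inner ℝ (χ τ) (P τ), ?_,
    fun τ => (hy' τ).sub_const _, fun τ => ?_⟩
  · simp only [hP0]
    simp [Complex.inner]
    ring_nf
  · refine (((hχ τ).inner ℝ (hP τ)).const_mul 2).congr_deriv ?_
    have h1 : inner ℝ (χ τ) (-(((κ ^ 2 + primitive t₀ v τ : ℝ) : ℂ) * χ τ)) =
        -(κ ^ 2 + primitive t₀ v τ) * ‖χ τ‖ ^ 2 := by
      rw [← Complex.real_smul, inner_neg_right, inner_smul_right, real_inner_self_eq_norm_sq]; ring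
    have h2 := hEeq τ
    have h3 := hzτ τ
    simp only [hE] at h2
    rw [h1, real_inner_self_eq_norm_sq]
    have h4 : ‖P τ‖ ^ 2 = κ + primitive t₀ v τ / (2 * κ) +
      primitive t₀ (fun ζ => v ζ * modeDeviation t₀ κ v ζ) τ -
      (κ ^ 2 + primitive t₀ v τ) * ‖χ τ‖ ^ 2 := by linarith
    rw [h4, h3]
    field_simp
    ring

theorem modeDeviation_eq {κ : ℝ} (hκ : 0 < κ) (t₀ : ℝ) {v : ℝ → ℝ} (hv : Continuous v) (τ : ℝ) :
    modeDeviation t₀ κ v τ + primitive t₀ v τ / (4 * κ ^ 3) =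
      cosTransform t₀ v τ κ / (4 * κ ^ 3) + modeRemainder t₀ κ v τ := by
  obtain ⟨hz0, z', hz'0, hz, hz'⟩ := modeDeviation_hasDerivAt hκ t₀ hv
  have hzc := continuous_modeDeviation hκ t₀ hv
  have hV := continuous_primitive t₀ hv
  have hQ : Continuous (primitive t₀ fun ζ => v ζ * modeDeviation t₀ κ v ζ) :=
    continuous_primitive t₀ (hv.mul hzc)
  have hlin : ∀ η, HasDerivAt (fun η => 2 * κ * (τ - η)) (-(2 * κ)) η := fun η => by
    simpa using ((hasDerivAt_id η).const_sub τ).const_mul (2 * κ)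
  have hsin := fun η => (hlin η).sin
  have hcos := fun η => (hlin η).cos
  -- The first two terms are Duhamel's formula for the frequency 2κ. The third performs the
  -- integration by parts that moves the derivative of the cosine onto V. At `τ` the primitive is
  -- the left side of the claim; at `t₀` it vanishes.
  have key : ∀ η, HasDerivAt (fun η => sin (2 * κ * (τ - η)) / (2 * κ) * z' η +
      cos (2 * κ * (τ - η)) * modeDeviation t₀ κ v η +
        cos (2 * κ * (τ - η)) * primitive t₀ v η / (4 * κ ^ 3))
      (sin (2 * κ * (τ - η)) / (2 * κ) *
        (2 * primitive t₀ (fun ζ => v ζ * modeDeviation t₀ κ v ζ) η -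
          4 * primitive t₀ v η * modeDeviation t₀ κ v η) +
        cos (2 * κ * (τ - η)) * v η / (4 * κ ^ 3)) η := fun η => by
    refine (((((hsin η).div_const (2 * κ)).mul (hz' η)).add ((hcos η).mul (hz η))).add
      (((hcos η).mul (hasDerivAt_primitive t₀ hv η)).div_const (4 * κ ^ 3))).congr_deriv ?_
    field_simp
    ring
  have hc1 : Continuous fun η => sin (2 * κ * (τ - η)) / (2 * κ) *
        (2 * primitive t₀ (fun ζ => v ζ * modeDeviation t₀ κ v ζ) η -
          4 * primitive t₀ v η * modeDeviation t₀ κ v η) := by fun_prop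
  have hc2 : Continuous fun η => cos (2 * κ * (τ - η)) * v η / (4 * κ ^ 3) := by fun_prop
  have h := intervalIntegral.integral_eq_sub_of_hasDerivAt (a := t₀) (b := τ)
    (fun η _ => key η) ((hc1.add hc2).intervalIntegrable _ _)
  rw [intervalIntegral.integral_add (hc1.intervalIntegrable _ _) (hc2.intervalIntegrable _ _),
    intervalIntegral.integral_div] at h
  simp only [sub_self, mul_zero, sin_zero, cos_zero, zero_div, zero_mul, one_mul, zero_add, hz0,
    hz'0, primitive_self, add_zero, sub_zero] at h
  rw [← h, add_comm]
  rfl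

/-! ### Stability of the modes under changes of the potential -/

/-- Gronwall's inequality in integral form. -/
theorem le_mul_exp_of_le_add_integral {u : ℝ → ℝ} {t₀ t₁ A B : ℝ} (hu : Continuous u)
    (hB : 0 ≤ B) (h : ∀ τ ∈ Icc t₀ t₁, u τ ≤ A + B * ∫ η in t₀..τ, u η) {τ : ℝ}
    (hτ : τ ∈ Icc t₀ t₁) : u τ ≤ A * exp (B * (τ - t₀)) := by
  set U : ℝ → ℝ := fun τ => A + B * primitive t₀ u τ with hU
  have hU' : ∀ τ, HasDerivAt U (B * u τ) τ := fun τ =>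
    ((hasDerivAt_primitive t₀ hu τ).const_mul B).const_add A
  set F : ℝ → ℝ := fun τ => U τ * exp (-(B * (τ - t₀))) with hF
  have hF' : ∀ τ, HasDerivAt F (B * (u τ - U τ) * exp (-(B * (τ - t₀)))) τ := fun τ => by
    have h1 : HasDerivAt (fun τ => exp (-(B * (τ - t₀)))) (exp (-(B * (τ - t₀))) * -B) τ := by
      simpa using (((hasDerivAt_id τ).sub_const t₀).const_mul B).neg.exp
    exact ((hU' τ).mul h1).congr_deriv (by ring)
  have hanti : AntitoneOn F (Icc t₀ t₁) := by
    refine antitoneOn_of_deriv_nonpos (convex_Icc _ _)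
      (fun x _ => (hF' x).continuousAt.continuousWithinAt)
      (fun x _ => (hF' x).differentiableAt.differentiableWithinAt) fun x hx => ?_
    rw [(hF' x).deriv]
    rw [interior_Icc] at hx
    have := h x (Ioo_subset_Icc_self hx)
    have h2 : u x - U x ≤ 0 := by simp only [hU, primitive]; linarith
    exact mul_nonpos_of_nonpos_of_nonneg (mul_nonpos_of_nonneg_of_nonpos hB h2) (exp_pos _).le
  have h3 := hanti (left_mem_Icc.2 (hτ.1.trans hτ.2)) hτ hτ.1
  simp only [hF, hU, primitive_self, sub_self, mul_zero, neg_zero, exp_zero, add_zero,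
    mul_one] at h3
  have h4 : u τ ≤ U τ := h τ hτ
  rw [exp_neg, ← div_eq_mul_inv, div_le_iff₀ (exp_pos _)] at h3
  exact h4.trans h3

theorem abs_integral_le_of_abs_le {f g : ℝ → ℝ} {a b : ℝ} (hab : a ≤ b) (hg : Continuous g)
    (h : ∀ x ∈ Icc a b, |f x| ≤ g x) : |∫ x in a..b, f x| ≤ ∫ x in a..b, g x := by
  rw [← Real.norm_eq_abs]
  exact intervalIntegral.norm_integral_le_of_norm_le hab
    (.of_forall fun x hx => h x (Ioc_subset_Icc_self hx)) (hg.intervalIntegrable _ _)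

theorem abs_cosTransform_le {t₀ τ D : ℝ} {v : ℝ → ℝ} (h : t₀ ≤ τ)
    (hv : ∀ η ∈ Icc t₀ τ, |v η| ≤ D) (κ : ℝ) : |cosTransform t₀ v τ κ| ≤ D * (τ - t₀) := by
  refine abs_primitive_le h fun η hη => ?_
  rw [abs_mul]
  exact (mul_le_of_le_one_left (abs_nonneg _) (abs_cos_le_one _)).trans (hv η hη)

theorem cosTransform_sub (t₀ : ℝ) {v w : ℝ → ℝ} (hv : Continuous v) (hw : Continuous w)
    (τ κ : ℝ) : cosTransform t₀ (fun η => v η - w η) τ κ =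
      cosTransform t₀ v τ κ - cosTransform t₀ w τ κ := by
  unfold cosTransform
  rw [← intervalIntegral.integral_sub (Continuous.intervalIntegrable (by fun_prop) _ _)
    (Continuous.intervalIntegrable (by fun_prop) _ _)]
  simp only [mul_sub]

/-- The products are split as v z - w y = v (z - y) + (v - w) y. The difference z - y enters through
its time integral and not its supremum, as Gronwall's inequality requires. -/
theorem abs_modeRemainder_sub_le {κ t₀ L M D Z : ℝ} (hκ : 0 < κ)
    {v w : ℝ → ℝ} (hv : Continuous v) (hw : Continuous w) {s : ℝ} (hs : t₀ ≤ s) (hsL : s - t₀ ≤ L)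
    (hvM : ∀ η ∈ Icc t₀ s, |v η| ≤ M) (hD : ∀ η ∈ Icc t₀ s, |v η - w η| ≤ D)
    (hZ : ∀ η ∈ Icc t₀ s, |modeDeviation t₀ κ w η| ≤ Z) :
    |modeRemainder t₀ κ v s - modeRemainder t₀ κ w s| ≤ (3 * M * L *
      (∫ η in t₀..s, |modeDeviation t₀ κ v η - modeDeviation t₀ κ w η|) +
        3 * D * Z * L ^ 2) / κ := by
  have ht₀ : t₀ ∈ Icc t₀ s := left_mem_Icc.2 hs
  have hM0 : 0 ≤ M := (abs_nonneg _).trans (hvM _ ht₀)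
  have hD0 : 0 ≤ D := (abs_nonneg _).trans (hD _ ht₀)
  have hZ0 : 0 ≤ Z := (abs_nonneg _).trans (hZ _ ht₀)
  have hL0 : 0 ≤ L := (sub_nonneg.2 hs).trans hsL
  have hz := continuous_modeDeviation hκ t₀ hv
  have hy := continuous_modeDeviation hκ t₀ hw
  unfold modeRemainder
  set z := modeDeviation t₀ κ v
  set y := modeDeviation t₀ κ w
  set I := ∫ η in t₀..s, |z η - y η| with hI
  have hI0 : 0 ≤ I := intervalIntegral.integral_nonneg hs fun _ _ => abs_nonneg _
  have hV := continuous_primitive t₀ hv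
  have hW := continuous_primitive t₀ hw
  have hvz : Continuous fun ζ => v ζ * z ζ := hv.mul hz
  have hwy : Continuous fun ζ => w ζ * y ζ := hw.mul hy
  have hP := continuous_primitive t₀ hvz
  have hQ := continuous_primitive t₀ hwy
  have h1 : ∀ η ∈ Icc t₀ s, |primitive t₀ (fun ζ => v ζ * z ζ) η -
      primitive t₀ (fun ζ => w ζ * y ζ) η| ≤ M * I + D * Z * L := by
    intro η hη
    rw [← primitive_sub t₀ hvz hwy]
    calc _ ≤ ∫ ζ in t₀..η, (M * |z ζ - y ζ| + D * Z) := by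
          refine abs_integral_le_of_abs_le hη.1 (by fun_prop) fun ζ hζ => ?_
          have hζ' : ζ ∈ Icc t₀ s := ⟨hζ.1, hζ.2.trans hη.2⟩
          rw [show v ζ * z ζ - w ζ * y ζ = v ζ * (z ζ - y ζ) + (v ζ - w ζ) * y ζ by ring]
          refine (abs_add_le _ _).trans ?_
          rw [abs_mul, abs_mul]
          exact add_le_add (mul_le_mul_of_nonneg_right (hvM ζ hζ') (abs_nonneg _))
            (mul_le_mul (hD ζ hζ') (hZ ζ hζ') (abs_nonneg _) hD0)
      _ = M * (∫ ζ in t₀..η, |z ζ - y ζ|) + D * Z * (η - t₀) := by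
          rw [intervalIntegral.integral_add (Continuous.intervalIntegrable (by fun_prop) _ _)
            (by simp), intervalIntegral.integral_const_mul,
            intervalIntegral.integral_const, smul_eq_mul, mul_comm (η - t₀)]
      _ ≤ _ := by
          have : ∫ ζ in t₀..η, |z ζ - y ζ| ≤ I :=
            intervalIntegral.integral_mono_interval le_rfl hη.1 hη.2 (.of_forall fun _ =>
              abs_nonneg _) (Continuous.intervalIntegrable (by fun_prop) _ _)
          have h2 : η - t₀ ≤ L := by linarith [hη.2]
          gcongr
  have h2 : ∀ η ∈ Icc t₀ s, |primitive t₀ v η * z η - primitive t₀ w η * y η| ≤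
      M * L * |z η - y η| + D * L * Z := by
    intro η hη
    have hη2 : η - t₀ ≤ L := by linarith [hη.2]
    have hη3 : 0 ≤ η - t₀ := sub_nonneg.2 hη.1
    have ha : |primitive t₀ v η| ≤ M * L :=
      (abs_primitive_le hη.1 fun ζ hζ => hvM ζ ⟨hζ.1, hζ.2.trans hη.2⟩).trans (by gcongr)
    have hb : |primitive t₀ v η - primitive t₀ w η| ≤ D * L := by
      rw [← primitive_sub t₀ hv hw]
      exact (abs_primitive_le hη.1 fun ζ hζ => hD ζ ⟨hζ.1, hζ.2.trans hη.2⟩).trans (by gcongr)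
    rw [show primitive t₀ v η * z η - primitive t₀ w η * y η = primitive t₀ v η * (z η - y η) +
      (primitive t₀ v η - primitive t₀ w η) * y η by ring]
    refine (abs_add_le _ _).trans ?_
    rw [abs_mul, abs_mul]
    exact add_le_add (mul_le_mul_of_nonneg_right ha (abs_nonneg _))
      (mul_le_mul hb (hZ η hη) (abs_nonneg _) (by positivity))
  rw [← intervalIntegral.integral_sub (Continuous.intervalIntegrable (by fun_prop) _ _)
    (Continuous.intervalIntegrable (by fun_prop) _ _)]
  calc _ ≤ ∫ η in t₀..s, ((2 * (M * I + D * Z * L) + 4 * (D * L * Z)) / (2 * κ) +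
          4 * M * L / (2 * κ) * |z η - y η|) := by
        refine abs_integral_le_of_abs_le hs (by fun_prop) fun η hη => ?_
        have ha := h1 η hη
        have hb := h2 η hη
        rw [← mul_sub, abs_mul, abs_div, abs_of_pos (show 0 < 2 * κ by positivity)]
        set p := primitive t₀ (fun ζ => v ζ * z ζ) η
        set q := primitive t₀ (fun ζ => w ζ * y ζ) η
        have hc : |2 * p - 4 * primitive t₀ v η * z η - (2 * q - 4 * primitive t₀ w η * y η)| ≤
            2 * (M * I + D * Z * L) + 4 * (M * L * |z η - y η| + D * L * Z) := by
          rw [show 2 * p - 4 * primitive t₀ v η * z η - (2 * q - 4 * primitive t₀ w η * y η) =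
            2 * (p - q) - 4 * (primitive t₀ v η * z η - primitive t₀ w η * y η) by ring]
          refine (abs_sub _ _).trans ?_
          rw [abs_mul, abs_mul, abs_of_pos (two_pos : (0 : ℝ) < 2),
            abs_of_pos (four_pos : (0 : ℝ) < 4)]
          gcongr
        calc _ ≤ 1 / (2 * κ) *
              (2 * (M * I + D * Z * L) + 4 * (M * L * |z η - y η| + D * L * Z)) := by
              gcongr
              exact abs_sin_le_one _
          _ = _ := by ring
    _ = (2 * (M * I + D * Z * L) + 4 * (D * L * Z)) / (2 * κ) * (s - t₀) +
          4 * M * L / (2 * κ) * I := by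
        rw [intervalIntegral.integral_add (by simp)
          (Continuous.intervalIntegrable (by fun_prop) _ _), intervalIntegral.integral_const_mul,
          intervalIntegral.integral_const, smul_eq_mul, mul_comm (s - t₀)]
    _ ≤ (2 * (M * I + D * Z * L) + 4 * (D * L * Z)) / (2 * κ) * L +
          4 * M * L / (2 * κ) * I := by gcongr
    _ = _ := by field_simp; ring

/-- By `modeDeviation_eq` the part linear in v - w is at most `D * L / (2 * κ ^ 3)`; the rest is a
remainder difference, to which Gronwall's inequality applies. -/
theorem abs_modeDeviation_sub_le {κ t₀ L M D Z : ℝ} (hκ : 0 < κ)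
    {v w : ℝ → ℝ} (hv : Continuous v) (hw : Continuous w) {τ : ℝ} (hτL : τ - t₀ ≤ L)
    (hvM : ∀ η ∈ Icc t₀ τ, |v η| ≤ M) (hD : ∀ η ∈ Icc t₀ τ, |v η - w η| ≤ D)
    (hZ : ∀ η ∈ Icc t₀ τ, |modeDeviation t₀ κ w η| ≤ Z) {s : ℝ} (hs : s ∈ Icc t₀ τ) :
    |modeDeviation t₀ κ v s - modeDeviation t₀ κ w s| ≤
      (D * L / (2 * κ ^ 3) + 3 * D * Z * L ^ 2 / κ) * exp (3 * M * L / κ * L) := by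
  have hst : t₀ ≤ τ := hs.1.trans hs.2
  have ht₀ : t₀ ∈ Icc t₀ τ := left_mem_Icc.2 hst
  have hM0 : 0 ≤ M := (abs_nonneg _).trans (hvM _ ht₀)
  have hD0 : 0 ≤ D := (abs_nonneg _).trans (hD _ ht₀)
  have hZ0 : 0 ≤ Z := (abs_nonneg _).trans (hZ _ ht₀)
  have hL0 : 0 ≤ L := (sub_nonneg.2 hst).trans hτL
  have hz := continuous_modeDeviation hκ t₀ hv
  have hy := continuous_modeDeviation hκ t₀ hw
  have key := le_mul_exp_of_le_add_integral (t₀ := t₀) (t₁ := τ)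
    (u := fun s => |modeDeviation t₀ κ v s - modeDeviation t₀ κ w s|)
    (A := D * L / (2 * κ ^ 3) + 3 * D * Z * L ^ 2 / κ) (B := 3 * M * L / κ) (hz.sub hy).abs
    (by positivity) (fun s hs => ?_) hs
  · refine key.trans ?_
    have : s - t₀ ≤ L := by linarith [hs.2]
    gcongr
  · have hsub : Icc t₀ s ⊆ Icc t₀ τ := Icc_subset_Icc_right hs.2
    have hsL : s - t₀ ≤ L := by linarith [hs.2]
    have h1 := abs_modeRemainder_sub_le hκ hv hw hs.1 hsL (fun η hη => hvM η (hsub hη))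
      (fun η hη => hD η (hsub hη)) (fun η hη => hZ η (hsub hη))
    have h2 := abs_cosTransform_le hs.1 (v := fun η => v η - w η) (fun η hη => hD η (hsub hη)) κ
    have h3 := abs_primitive_le hs.1 (v := fun η => v η - w η) (fun η hη => hD η (hsub hη))
    rw [cosTransform_sub t₀ hv hw] at h2
    rw [primitive_sub t₀ hv hw] at h3
    have e1 := modeDeviation_eq hκ t₀ hv s
    have e2 := modeDeviation_eq hκ t₀ hw s
    have e3 : modeDeviation t₀ κ v s - modeDeviation t₀ κ w s =
        ((cosTransform t₀ v s κ - cosTransform t₀ w s κ) -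
          (primitive t₀ v s - primitive t₀ w s)) / (4 * κ ^ 3) +
        (modeRemainder t₀ κ v s - modeRemainder t₀ κ w s) := by
      rw [sub_div, sub_div, sub_div]; linarith
    rw [e3]
    refine (abs_add_le _ _).trans ?_
    have h4 : |((cosTransform t₀ v s κ - cosTransform t₀ w s κ) -
          (primitive t₀ v s - primitive t₀ w s)) / (4 * κ ^ 3)| ≤ D * L / (2 * κ ^ 3) := by
      rw [abs_div, abs_of_pos (show 0 < 4 * κ ^ 3 by positivity)]
      calc _ ≤ (D * (s - t₀) + D * (s - t₀)) / (4 * κ ^ 3) := by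
            gcongr; exact (abs_sub _ _).trans (add_le_add h2 h3)
        _ ≤ (D * L + D * L) / (4 * κ ^ 3) := by gcongr
        _ = _ := by field_simp; ring
    calc _ ≤ _ := add_le_add h4 h1
      _ = _ := by ring

@[simp] theorem primitive_zero (t₀ : ℝ) : primitive t₀ (fun _ => 0) = fun _ => 0 := by
  ext; simp [primitive]

@[simp] theorem cosTransform_zero (t₀ τ κ : ℝ) : cosTransform t₀ (fun _ => 0) τ κ = 0 := by
  simp [cosTransform]

@[simp] theorem modeRemainder_zero (t₀ κ τ : ℝ) : modeRemainder t₀ κ (fun _ => 0) τ = 0 := by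
  simp [modeRemainder]

theorem modeDeviation_zero {κ : ℝ} (hκ : 0 < κ) (t₀ τ : ℝ) :
    modeDeviation t₀ κ (fun _ => 0) τ = 0 := by
  simpa using modeDeviation_eq hκ t₀ (v := fun _ => 0) continuous_const τ

/-- The deviations and their differences are O(κ⁻³), and the Duhamel kernel supplies one more factor
κ⁻¹. The lower bound μ on the frequencies makes the Gronwall factors uniform. -/
theorem exists_abs_modeRemainder_sub_le {μ M L : ℝ} (hμ : 0 < μ) (hM : 0 ≤ M) (hL : 0 ≤ L) :
    ∃ C, 0 ≤ C ∧ ∀ κ, μ ≤ κ → ∀ t₀ τ, t₀ ≤ τ → τ - t₀ ≤ L → ∀ v w : ℝ → ℝ, Continuous v →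
      Continuous w → (∀ η ∈ Icc t₀ τ, |v η| ≤ M) → (∀ η ∈ Icc t₀ τ, |w η| ≤ M) →
      ∀ D, (∀ η ∈ Icc t₀ τ, |v η - w η| ≤ D) →
        |modeRemainder t₀ κ v τ - modeRemainder t₀ κ w τ| ≤ C * D / κ ^ 4 := by
  set E := exp (3 * M * L / μ * L) with hE
  set Y := M * L / 2 * E with hY
  have hY0 : 0 ≤ Y := by positivity
  refine ⟨3 * M * L ^ 2 * ((L / 2 + 3 * L ^ 2 * Y / μ) * E) + 3 * L ^ 2 * Y, by positivity, ?_⟩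
  intro κ hμκ t₀ τ hτ hτL v w hv hw hvM hwM D hD
  have hκ : 0 < κ := hμ.trans_le hμκ
  have hD0 : 0 ≤ D := (abs_nonneg _).trans (hD _ (left_mem_Icc.2 hτ))
  have hexp : exp (3 * M * L / κ * L) ≤ E := by rw [hE]; gcongr
  have hZ : ∀ η ∈ Icc t₀ τ, |modeDeviation t₀ κ w η| ≤ Y / κ ^ 3 := by
    intro η hη
    -- Comparison with the zero potential, whose deviation vanishes, yields the a priori bound.
    have h := abs_modeDeviation_sub_le (Z := 0) (D := M) (M := M) hκ hw
      (w := fun _ => 0) continuous_const hτL hwM (by simpa using hwM)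
      (fun s _ => by rw [modeDeviation_zero hκ, abs_zero]) hη
    rw [modeDeviation_zero hκ, sub_zero] at h
    refine h.trans ?_
    calc _ ≤ (M * L / (2 * κ ^ 3) + 3 * M * 0 * L ^ 2 / κ) * E := by gcongr
      _ = Y / κ ^ 3 := by rw [hY]; field_simp; ring
  have hu : ∀ s ∈ Icc t₀ τ, |modeDeviation t₀ κ v s - modeDeviation t₀ κ w s| ≤
      D * ((L / 2 + 3 * L ^ 2 * Y / μ) * E) / κ ^ 3 := by
    intro s hs
    refine (abs_modeDeviation_sub_le hκ hv hw hτL hvM hD hZ hs).trans ?_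
    calc _ ≤ (D * L / (2 * κ ^ 3) + 3 * D * (Y / κ ^ 3) * L ^ 2 / μ) * E := by gcongr
      _ = _ := by field_simp
  refine (abs_modeRemainder_sub_le hκ hv hw hτ hτL hvM hD hZ).trans ?_
  have hI : ∫ η in t₀..τ, |modeDeviation t₀ κ v η - modeDeviation t₀ κ w η| ≤
      L * (D * ((L / 2 + 3 * L ^ 2 * Y / μ) * E) / κ ^ 3) := by
    calc _ ≤ ∫ η in t₀..τ, D * ((L / 2 + 3 * L ^ 2 * Y / μ) * E) / κ ^ 3 :=
          intervalIntegral.integral_mono_on hτ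
            (((continuous_modeDeviation hκ t₀ hv).sub
              (continuous_modeDeviation hκ t₀ hw)).abs.intervalIntegrable _ _) (by simp) hu
      _ = (τ - t₀) * (D * ((L / 2 + 3 * L ^ 2 * Y / μ) * E) / κ ^ 3) := by
          rw [intervalIntegral.integral_const, smul_eq_mul]
      _ ≤ _ := by gcongr
  calc _ ≤ (3 * M * L * (L * (D * ((L / 2 + 3 * L ^ 2 * Y / μ) * E) / κ ^ 3)) +
        3 * D * (Y / κ ^ 3) * L ^ 2) / κ := by gcongr
    _ = _ := by field_simp

/-! ### Square integrability of the cosine transform -/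

theorem integral_exp_mul_cos_Ioi {ε : ℝ} (hε : 0 < ε) (b : ℝ) :
    IntegrableOn (fun x => exp (-ε * x) * cos (b * x)) (Ioi 0) ∧
      ∫ x in Ioi 0, exp (-ε * x) * cos (b * x) = ε / (ε ^ 2 + b ^ 2) := by
  have hre : (-(ε : ℂ) + b * Complex.I).re < 0 := by simpa using hε
  have hint := integrableOn_exp_mul_complex_Ioi hre 0
  have hfun : ∀ x : ℝ, (Complex.exp ((-(ε : ℂ) + b * Complex.I) * x)).re =
      exp (-ε * x) * cos (b * x) := fun x => by
    rw [Complex.exp_re]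
    simp
  have h1 := hint.re
  simp only [RCLike.re_eq_complex_re, hfun] at h1
  refine ⟨h1, ?_⟩
  have h2 := integral_re hint
  simp only [RCLike.re_eq_complex_re, hfun] at h2
  rw [h2, integral_exp_mul_complex_Ioi hre 0]
  simp [Complex.div_re, Complex.normSq_apply]
  field_simp

/-- The bound is independent of ε, of the interval and of the centre, so it survives the removal of
the regularization. -/
theorem integral_poisson_le {ε : ℝ} (hε : 0 < ε) (a b y : ℝ) :
    ∫ x in a..b, ε / (ε ^ 2 + (2 * (x - y)) ^ 2) ≤ π / 2 := by
  have hd : ∀ x, HasDerivAt (fun x => arctan (2 * (x - y) / ε) / 2)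
      (ε / (ε ^ 2 + (2 * (x - y)) ^ 2)) x := fun x => by
    have h := (((((hasDerivAt_id x).sub_const y).const_mul 2).div_const ε).arctan).div_const 2
    refine h.congr_deriv ?_
    simp only [id]
    have h2 : ε ^ 2 + (2 * (x - y)) ^ 2 ≠ 0 := by positivity
    field_simp
  rw [intervalIntegral.integral_eq_sub_of_hasDerivAt (fun x _ => hd x)
    (Continuous.intervalIntegrable (Continuous.div (by fun_prop) (by fun_prop)
      fun x => by positivity) _ _)]
  linarith [arctan_lt_pi_div_two (2 * (b - y) / ε), neg_pi_div_two_lt_arctan (2 * (a - y) / ε)]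

theorem continuous_cosTransform (t₀ : ℝ) {v : ℝ → ℝ} (hv : Continuous v) (τ : ℝ) :
    Continuous (cosTransform t₀ v τ) :=
  intervalIntegral.continuous_parametric_intervalIntegral_of_continuous'
    (f := fun κ η => cos (2 * κ * (τ - η)) * v η) (by fun_prop) _ _

/-- The exponential weight justifies Fubini's theorem. The integral over κ of the product of two
cosines is then a sum of two Poisson kernels, one of them centred at the reflected point 2τ - y, and
each has mass at most π / 2. -/
theorem integral_exp_mul_cosTransform_sq_le {ε : ℝ} (hε : 0 < ε) {t₀ τ D : ℝ} (hτ : t₀ ≤ τ)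
    {v : ℝ → ℝ} (hv : Continuous v) (hD : ∀ η ∈ Icc t₀ τ, |v η| ≤ D) :
    ∫ κ in Ioi 0, exp (-ε * κ) * cosTransform t₀ v τ κ ^ 2 ≤ D ^ 2 * (τ - t₀) * (π / 2) := by
  have hD0 : 0 ≤ D := (abs_nonneg _).trans (hD _ (left_mem_Icc.2 hτ))
  set ν : Measure ℝ := volume.restrict (Ioc t₀ τ) with hν
  set F : ℝ → ℝ × ℝ → ℝ := fun κ q => exp (-ε * κ) *
    ((cos (2 * κ * (τ - q.1)) * v q.1) * (cos (2 * κ * (τ - q.2)) * v q.2)) with hF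
  have hmem : ∀ᵐ q ∂(ν.prod ν), q ∈ Ioc t₀ τ ×ˢ Ioc t₀ τ := by
    rw [hν, Measure.prod_restrict]
    exact ae_restrict_mem (measurableSet_Ioc.prod measurableSet_Ioc)
  have hFc : Continuous (Function.uncurry F) := by
    simp only [hF, Function.uncurry_def]
    fun_prop
  have hFint : Integrable (Function.uncurry F) ((volume.restrict (Ioi 0)).prod (ν.prod ν)) := by
    have h1 : Integrable (fun z : ℝ × ℝ × ℝ => exp (-ε * z.1) * D ^ 2)
        ((volume.restrict (Ioi 0)).prod (ν.prod ν)) :=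
      Integrable.mul_prod (f := fun κ => exp (-ε * κ)) (g := fun _ => D ^ 2)
        (exp_neg_integrableOn_Ioi 0 hε) (integrable_const _)
    refine h1.mono' hFc.aestronglyMeasurable ?_
    have h2 : ∀ᵐ z ∂((volume.restrict (Ioi (0 : ℝ))).prod (ν.prod ν)),
        z.2 ∈ Ioc t₀ τ ×ˢ Ioc t₀ τ :=
      Measure.quasiMeasurePreserving_snd.ae hmem
    filter_upwards [h2] with z hz
    simp only [Function.uncurry_def, hF, norm_mul, Real.norm_eq_abs, abs_exp]
    have ha := hD z.2.1 (Ioc_subset_Icc_self hz.1)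
    have hb := hD z.2.2 (Ioc_subset_Icc_self hz.2)
    calc _ ≤ exp (-ε * z.1) * ((1 * D) * (1 * D)) := by
          gcongr
          · exact abs_cos_le_one _
          · exact abs_cos_le_one _
      _ = _ := by ring
  have hL : ∀ κ, ∫ q, F κ q ∂(ν.prod ν) = exp (-ε * κ) * cosTransform t₀ v τ κ ^ 2 := fun κ => by
    simp only [hF]
    rw [integral_const_mul, integral_prod_mul (fun η => cos (2 * κ * (τ - η)) * v η)
      (fun η => cos (2 * κ * (τ - η)) * v η), cosTransform,
      intervalIntegral.integral_of_le hτ, sq]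
  set K : ℝ → ℝ → ℝ := fun y x => ε / (ε ^ 2 + (2 * (x - y)) ^ 2) with hK
  have hR : ∀ q : ℝ × ℝ, ∫ κ in Ioi 0, F κ q = v q.1 * v q.2 *
      ((K q.2 q.1 + K (2 * τ - q.2) q.1) / 2) := fun q => by
    have h1 := integral_exp_mul_cos_Ioi hε (2 * (q.1 - q.2))
    have h2 := integral_exp_mul_cos_Ioi hε (2 * (q.1 - (2 * τ - q.2)))
    rw [hK]
    simp only
    rw [← h1.2, ← h2.2, ← integral_add h1.1 h2.1, ← integral_div, ← integral_const_mul]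
    refine integral_congr_ae (.of_forall fun κ => ?_)
    simp only [hF]
    have e1 : cos (2 * (q.1 - q.2) * κ) = cos (2 * κ * (τ - q.1) - 2 * κ * (τ - q.2)) := by
      rw [← cos_neg]; congr 1; ring
    have e2 : cos (2 * (q.1 - (2 * τ - q.2)) * κ) =
        cos (2 * κ * (τ - q.1) + 2 * κ * (τ - q.2)) := by
      rw [← cos_neg]; congr 1; ring
    rw [e1, e2, cos_add, cos_sub]
    ring
  have hKpos : ∀ y x, 0 ≤ K y x := fun y x => by simp only [hK]; positivity
  have hKc : Continuous fun q : ℝ × ℝ => (K q.2 q.1 + K (2 * τ - q.2) q.1) / 2 := by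
    simp only [hK]
    refine ((Continuous.div (by fun_prop) (by fun_prop) fun x => by positivity).add
      (Continuous.div (by fun_prop) (by fun_prop) fun x => by positivity)).div_const _
  have hKint : Integrable (fun q : ℝ × ℝ => (K q.2 q.1 + K (2 * τ - q.2) q.1) / 2)
      (ν.prod ν) := by
    rw [hν, Measure.prod_restrict]
    exact (hKc.continuousOn.integrableOn_compact (isCompact_Icc.prod isCompact_Icc)).mono_set
      (prod_mono Ioc_subset_Icc_self Ioc_subset_Icc_self)
  calc ∫ κ in Ioi 0, exp (-ε * κ) * cosTransform t₀ v τ κ ^ 2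
      = ∫ κ in Ioi 0, ∫ q, F κ q ∂(ν.prod ν) := by simp only [hL]
    _ = ∫ q, v q.1 * v q.2 * ((K q.2 q.1 + K (2 * τ - q.2) q.1) / 2) ∂(ν.prod ν) := by
        rw [integral_integral_swap hFint]; simp only [hR]
    _ ≤ ∫ q, D ^ 2 * ((K q.2 q.1 + K (2 * τ - q.2) q.1) / 2) ∂(ν.prod ν) := by
        refine (Real.le_norm_self _).trans (norm_integral_le_of_norm_le (hKint.const_mul _) ?_)
        filter_upwards [hmem] with q hq
        have ha := hD q.1 (Ioc_subset_Icc_self hq.1)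
        have hb := hD q.2 (Ioc_subset_Icc_self hq.2)
        have hk : 0 ≤ (K q.2 q.1 + K (2 * τ - q.2) q.1) / 2 :=
          div_nonneg (add_nonneg (hKpos _ _) (hKpos _ _)) two_pos.le
        rw [norm_mul, norm_mul, Real.norm_of_nonneg hk, sq]
        gcongr
        · exact ha
        · exact hb
    _ = ∫ y, ∫ x, D ^ 2 * ((K y x + K (2 * τ - y) x) / 2) ∂ν ∂ν := by
        rw [integral_prod_symm _ (hKint.const_mul _)]
    _ ≤ ∫ y, D ^ 2 * (π / 2) ∂ν := by
        refine integral_mono_of_nonneg (.of_forall fun y => integral_nonneg fun x =>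
          mul_nonneg (sq_nonneg _) (div_nonneg (add_nonneg (hKpos _ _) (hKpos _ _)) two_pos.le))
          (integrable_const _) (.of_forall fun y => ?_)
        simp only
        have hKy : ∀ y, Continuous (K y) := fun y => by
          simp only [hK]
          exact Continuous.div (by fun_prop) (by fun_prop) fun x => by positivity
        rw [integral_const_mul, integral_div, integral_add
          (hKy _).integrableOn_Ioc (hKy _).integrableOn_Ioc]
        have h1 := integral_poisson_le hε t₀ τ y
        have h2 := integral_poisson_le hε t₀ τ (2 * τ - y)
        rw [intervalIntegral.integral_of_le hτ] at h1 h2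
        gcongr
        linarith
    _ = _ := by
        rw [integral_const, hν, measureReal_restrict_apply_univ, Real.volume_real_Ioc_of_le hτ,
          smul_eq_mul]
        ring

/-- With ε = 1 / (n + 1) the weight is at least e⁻¹ on [0, n + 1]. This is the origin of the factor
`exp 1`. -/
theorem cosTransform_sq_integrable {t₀ τ D : ℝ} (hτ : t₀ ≤ τ)
    {v : ℝ → ℝ} (hv : Continuous v) (hD : ∀ η ∈ Icc t₀ τ, |v η| ≤ D) :
    IntegrableOn (fun κ => cosTransform t₀ v τ κ ^ 2) (Ioi 0) ∧
      ∫ κ in Ioi 0, cosTransform t₀ v τ κ ^ 2 ≤ exp 1 * (D ^ 2 * (τ - t₀) * (π / 2)) := by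
  have hc := continuous_cosTransform t₀ hv τ
  have hbound : ∀ n : ℕ, ∫ κ in (0 : ℝ)..(n + 1 : ℝ), ‖cosTransform t₀ v τ κ ^ 2‖ ≤
      exp 1 * (D ^ 2 * (τ - t₀) * (π / 2)) := by
    intro n
    have hn : (0 : ℝ) < n + 1 := by positivity
    have hε : (0 : ℝ) < 1 / (n + 1) := by positivity
    have hint : IntegrableOn (fun κ => exp (-(1 / (n + 1 : ℝ)) * κ) * cosTransform t₀ v τ κ ^ 2)
        (Ioi 0) := by
      refine ((exp_neg_integrableOn_Ioi 0 hε).mul_const ((D * (τ - t₀)) ^ 2)).mono'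
        (Continuous.aestronglyMeasurable (by fun_prop)) (.of_forall fun κ => ?_)
      rw [norm_mul, Real.norm_eq_abs, abs_exp, Real.norm_eq_abs, abs_pow]
      gcongr
      exact abs_cosTransform_le hτ hD κ
    calc _ ≤ ∫ κ in (0 : ℝ)..(n + 1 : ℝ),
          exp 1 * (exp (-(1 / (n + 1 : ℝ)) * κ) * cosTransform t₀ v τ κ ^ 2) := by
          refine intervalIntegral.integral_mono_on hn.le
            (Continuous.intervalIntegrable (by fun_prop) _ _)
            (Continuous.intervalIntegrable (by fun_prop) _ _) fun κ hκ => ?_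
          rw [Real.norm_of_nonneg (sq_nonneg _), ← mul_assoc, ← exp_add]
          refine le_mul_of_one_le_left (sq_nonneg _) (one_le_exp ?_)
          have : κ / (n + 1) ≤ 1 := (div_le_one hn).2 hκ.2
          linarith [show 1 / (n + 1 : ℝ) * κ = κ / (n + 1) by ring]
      _ = exp 1 * ∫ κ in Ioc (0 : ℝ) (n + 1 : ℝ),
          exp (-(1 / (n + 1 : ℝ)) * κ) * cosTransform t₀ v τ κ ^ 2 := by
          rw [intervalIntegral.integral_const_mul, intervalIntegral.integral_of_le hn.le]
      _ ≤ exp 1 * ∫ κ in Ioi 0, exp (-(1 / (n + 1 : ℝ)) * κ) * cosTransform t₀ v τ κ ^ 2 := by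
          exact mul_le_mul_of_nonneg_left (setIntegral_mono_set hint
            (.of_forall fun κ => by positivity) Ioc_subset_Ioi_self.eventuallyLE) (exp_pos _).le
      _ ≤ _ := by
          gcongr
          exact integral_exp_mul_cosTransform_sq_le hε hτ hv hD
  have hlim : Tendsto (fun n : ℕ => (n + 1 : ℝ)) atTop atTop :=
    tendsto_atTop_add_const_right _ _ tendsto_natCast_atTop_atTop
  have hI : IntegrableOn (fun κ => cosTransform t₀ v τ κ ^ 2) (Ioi 0) :=
    integrableOn_Ioi_of_intervalIntegral_norm_bounded _ 0
      (fun n => (hc.pow 2).integrableOn_Ioc) hlim (.of_forall hbound)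
  refine ⟨hI, le_of_tendsto (intervalIntegral_tendsto_integral_Ioi 0 hI hlim)
    (.of_forall fun n => ?_)⟩
  have := hbound n
  simpa only [Real.norm_of_nonneg (sq_nonneg _)] using this

/-! ### Momentum integrals of radial functions -/

/-- The frequency of a mode of momentum `k` for the mass `μ`. -/
def dispersion (μ k : ℝ) : ℝ := √(k ^ 2 + μ ^ 2)

theorem continuous_dispersion (μ : ℝ) : Continuous (dispersion μ) := by
  unfold dispersion; fun_prop

theorem le_dispersion {μ : ℝ} (k : ℝ) : μ ≤ dispersion μ k :=
  Real.le_sqrt_of_sq_le (by nlinarith)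

theorem dispersion_pos {μ : ℝ} (hμ : 0 < μ) (k : ℝ) : 0 < dispersion μ k :=
  hμ.trans_le (le_dispersion k)

/-- The volume of the unit sphere in `ℝ ^ 3`, in the form in which it arises from polar
coordinates. -/
def sphereConst : ℝ := 3 * volume.real (Metric.ball (0 : EuclideanSpace ℝ (Fin 3)) 1)

theorem sphereConst_nonneg : 0 ≤ sphereConst := mul_nonneg (by norm_num) measureReal_nonneg

/-- From κ dκ = k dk one gets k² dk / κ² = (k / κ) dκ ≤ dκ, so the volume element of ℝ³ uses up
exactly the factor κ⁻². -/
theorem integrable_radial {μ : ℝ} (hμ : 0 < μ) {F : ℝ → ℝ} (hFm : Measurable F)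
    (hF : IntegrableOn F (Ioi μ)) (hF0 : ∀ x, 0 ≤ F x) :
    Integrable (fun k : EuclideanSpace ℝ (Fin 3) => F (dispersion μ ‖k‖) / dispersion μ ‖k‖ ^ 2) ∧
      ∫ k : EuclideanSpace ℝ (Fin 3), F (dispersion μ ‖k‖) / dispersion μ ‖k‖ ^ 2 ≤
        sphereConst * ∫ κ in Ioi μ, F κ := by
  have hd : ∀ k ∈ Ioi (0 : ℝ), HasDerivWithinAt (dispersion μ) (k / dispersion μ k) (Ioi 0) k := by
    intro k _
    have h1 : HasDerivAt (fun k => k ^ 2 + μ ^ 2) (2 * k) k := by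
      simpa using (hasDerivAt_pow 2 k).add_const (μ ^ 2)
    refine (h1.sqrt (by positivity)).hasDerivWithinAt.congr_deriv ?_
    rw [dispersion, mul_div_mul_left _ _ two_ne_zero]
  have hinj : InjOn (dispersion μ) (Ioi 0) := by
    intro x hx y hy hxy
    have h := (Real.sqrt_inj (by positivity) (by positivity)).1 hxy
    exact (pow_left_inj₀ (le_of_lt hx) (le_of_lt hy) two_ne_zero).1 (by linarith)
  have himg : dispersion μ '' Ioi 0 ⊆ Ioi μ := by
    rintro _ ⟨k, hk, rfl⟩
    have hk' : 0 < k := hk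
    exact Real.lt_sqrt_of_sq_lt (by nlinarith)
  have hI := (integrableOn_image_iff_integrableOn_abs_deriv_smul measurableSet_Ioi hd hinj F).1
    (hF.mono_set himg)
  have hE := integral_image_eq_integral_abs_deriv_smul measurableSet_Ioi hd hinj F
  have hle : ∫ κ in dispersion μ '' Ioi 0, F κ ≤ ∫ κ in Ioi μ, F κ :=
    setIntegral_mono_set hF (.of_forall hF0) himg.eventuallyLE
  have hb : ∀ k ∈ Ioi (0 : ℝ), ‖k ^ (3 - 1) • (F (dispersion μ k) / dispersion μ k ^ 2)‖ ≤
      |k / dispersion μ k| • F (dispersion μ k) := by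
    intro k hk
    have hk' : 0 < k := hk
    have hω := dispersion_pos hμ k
    have hkω : k / dispersion μ k ≤ 1 := (div_le_one hω).2 (Real.le_sqrt_of_sq_le (by nlinarith))
    have h0 : 0 ≤ k / dispersion μ k := by positivity
    have hf := hF0 (dispersion μ k)
    rw [smul_eq_mul, smul_eq_mul, Real.norm_of_nonneg (by positivity), abs_of_nonneg h0]
    calc _ = (k / dispersion μ k) * (k / dispersion μ k) * F (dispersion μ k) := by
          field_simp; norm_num; ring
      _ ≤ 1 * (k / dispersion μ k) * F (dispersion μ k) := by gcongr
      _ = _ := by ring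
  have hint : IntegrableOn (fun k => k ^ (3 - 1) • (F (dispersion μ k) / dispersion μ k ^ 2))
      (Ioi 0) := by
    refine Integrable.mono' hI ?_ ((ae_restrict_iff' measurableSet_Ioi).2 (.of_forall hb))
    have hm := (continuous_dispersion μ).measurable
    exact ((measurable_id.pow_const 2).mul ((hFm.comp hm).div (hm.pow_const 2))).aestronglyMeasurable
  constructor
  · rw [integrable_fun_norm_addHaar volume (f := fun k => F (dispersion μ k) / dispersion μ k ^ 2)]
    simpa using hint
  · rw [integral_fun_norm_addHaar volume (fun k => F (dispersion μ k) / dispersion μ k ^ 2)]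
    have hfin : Module.finrank ℝ (EuclideanSpace ℝ (Fin 3)) = 3 := by simp
    rw [hfin, nsmul_eq_mul, smul_eq_mul, ← mul_assoc]
    refine mul_le_mul_of_nonneg_left ?_ sphereConst_nonneg
    refine le_trans ?_ (hE.symm.le.trans hle)
    exact (Real.le_norm_self _).trans (norm_integral_le_of_norm_le hI
      ((ae_restrict_iff' measurableSet_Ioi).2 (.of_forall hb)))

theorem integrableOn_inv_sq_Ioi {μ : ℝ} (hμ : 0 < μ) :
    IntegrableOn (fun κ : ℝ => 1 / κ ^ 2) (Ioi μ) := by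
  refine (integrableOn_Ioi_rpow_of_lt (show (-2 : ℝ) < -1 by norm_num) hμ).congr_fun
    (fun x hx => ?_) measurableSet_Ioi
  have hx' : 0 < x := hμ.trans hx
  simp only
  rw [rpow_neg hx'.le, one_div]
  norm_num

theorem integrable_dispersion_pow_neg_four {μ : ℝ} (hμ : 0 < μ) :
    Integrable fun k : EuclideanSpace ℝ (Fin 3) => 1 / dispersion μ ‖k‖ ^ 4 := by
  have h := (integrable_radial hμ (F := fun κ => 1 / κ ^ 2) (by fun_prop)
    (integrableOn_inv_sq_Ioi hμ) fun x => by positivity).1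
  refine h.congr (.of_forall fun k => ?_)
  simp only
  rw [div_div, ← pow_add]

/-- After radial integration the weight κ⁻³ becomes κ⁻¹, which is square integrable at infinity, as
is the cosine transform. The Cauchy–Schwarz inequality is used in the form of a weighted
arithmetic-geometric mean. -/
theorem exists_integral_cosTransform_le {μ L : ℝ} (hμ : 0 < μ) (hL : 0 ≤ L) :
    ∃ C, 0 ≤ C ∧ ∀ t₀ τ, t₀ ≤ τ → τ - t₀ ≤ L → ∀ v : ℝ → ℝ, Continuous v → ∀ D,
      (∀ η ∈ Icc t₀ τ, |v η| ≤ D) →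
      Integrable (fun k : EuclideanSpace ℝ (Fin 3) =>
        cosTransform t₀ v τ (dispersion μ ‖k‖) / (4 * dispersion μ ‖k‖ ^ 3)) ∧
      ∫ k : EuclideanSpace ℝ (Fin 3),
        |cosTransform t₀ v τ (dispersion μ ‖k‖) / (4 * dispersion μ ‖k‖ ^ 3)| ≤ C * D := by
  set S := ∫ κ in Ioi μ, 1 / κ ^ 2 with hS
  have hS0 : 0 ≤ S := integral_nonneg fun _ => by positivity
  refine ⟨sphereConst * ((exp 1 * (L * (π / 2)) + S) / 8), by
    have := sphereConst_nonneg; positivity, ?_⟩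
  intro t₀ τ hτ hτL v hv D hD
  have hD0 : 0 ≤ D := (abs_nonneg _).trans (hD _ (left_mem_Icc.2 hτ))
  -- The weight of the mean involves 1 / D, so D = 0 is treated apart.
  rcases hD0.eq_or_lt with rfl | hDpos
  · have h0 : ∀ κ, cosTransform t₀ v τ κ = 0 := fun κ => by
      have := abs_cosTransform_le hτ hD κ
      rw [zero_mul] at this
      exact abs_nonpos_iff.1 this
    simp [h0]
  obtain ⟨hI, hB⟩ := cosTransform_sq_integrable hτ hv hD
  have hI' := hI.mono_set (Ioi_subset_Ioi hμ.le)
  have hB' : ∫ κ in Ioi μ, cosTransform t₀ v τ κ ^ 2 ≤ exp 1 * (D ^ 2 * L * (π / 2)) :=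
    calc _ ≤ _ := setIntegral_mono_set hI (.of_forall fun κ => sq_nonneg _)
          (Ioi_subset_Ioi hμ.le).eventuallyLE
      _ ≤ _ := hB
      _ ≤ _ := by gcongr
  have hc := continuous_cosTransform t₀ hv τ
  set F : ℝ → ℝ := fun κ => (cosTransform t₀ v τ κ ^ 2 / D + D * (1 / κ ^ 2)) / 8 with hF
  have h1 : IntegrableOn (fun κ => cosTransform t₀ v τ κ ^ 2 / D) (Ioi μ) := hI'.div_const D
  have h2 : IntegrableOn (fun κ : ℝ => D * (1 / κ ^ 2)) (Ioi μ) :=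
    (integrableOn_inv_sq_Ioi hμ).const_mul D
  have hFi : IntegrableOn F (Ioi μ) := (h1.add h2).div_const 8
  have hFv : ∫ κ in Ioi μ, F κ ≤ (exp 1 * (L * (π / 2)) + S) / 8 * D := by
    simp only [hF]
    rw [integral_div, integral_add h1 h2, integral_div, integral_const_mul, ← hS]
    calc _ ≤ (exp 1 * (D ^ 2 * L * (π / 2)) / D + D * S) / 8 := by gcongr
      _ = _ := by field_simp
  have hFm : Measurable F :=
    (((hc.measurable.pow_const 2).div_const D).add (by fun_prop)).div_const 8
  obtain ⟨hr1, hr2⟩ := integrable_radial hμ hFm hFi fun x => by simp only [hF]; positivity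
  have hdom : ∀ k : EuclideanSpace ℝ (Fin 3),
      |cosTransform t₀ v τ (dispersion μ ‖k‖) / (4 * dispersion μ ‖k‖ ^ 3)| ≤
        F (dispersion μ ‖k‖) / dispersion μ ‖k‖ ^ 2 := by
    intro k
    have hω := dispersion_pos hμ ‖k‖
    set ω := dispersion μ ‖k‖
    set c := cosTransform t₀ v τ ω
    rw [abs_div, abs_of_pos (show 0 < 4 * ω ^ 3 by positivity)]
    have hkey : |c| / (4 * ω) ≤ F ω := by
      simp only [hF]
      -- The weight is chosen so that both terms of `F` have integrals linear in D, since ∫ c² is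
      -- O(D²).
      have h3 : 0 ≤ (|c| - D / ω) ^ 2 / D := by positivity
      have h4 : (|c| - D / ω) ^ 2 / D = c ^ 2 / D + D * (1 / ω ^ 2) - 2 * |c| / ω := by
        rw [sub_sq, sq_abs]; field_simp; ring
      have h5 : |c| / (4 * ω) = (2 * |c| / ω) / 8 := by field_simp; ring
      rw [h5]
      change _ ≤ (c ^ 2 / D + D * (1 / ω ^ 2)) / 8
      linarith
    calc |c| / (4 * ω ^ 3) = |c| / (4 * ω) / ω ^ 2 := by field_simp
      _ ≤ _ := by gcongr
  have hmeas : Continuous fun k : EuclideanSpace ℝ (Fin 3) =>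
      cosTransform t₀ v τ (dispersion μ ‖k‖) / (4 * dispersion μ ‖k‖ ^ 3) := by
    have hd := (continuous_dispersion μ).comp (continuous_norm (E := EuclideanSpace ℝ (Fin 3)))
    refine (hc.comp hd).div (continuous_const.mul (hd.pow 3)) fun k => ?_
    have hω := dispersion_pos hμ ‖k‖
    exact (by positivity : 4 * dispersion μ ‖k‖ ^ 3 ≠ 0)
  have hint : Integrable fun k : EuclideanSpace ℝ (Fin 3) =>
      cosTransform t₀ v τ (dispersion μ ‖k‖) / (4 * dispersion μ ‖k‖ ^ 3) :=
    hr1.mono' hmeas.aestronglyMeasurable (.of_forall hdom)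
  refine ⟨hint, (integral_mono hint.abs hr1 hdom).trans (hr2.trans ?_)⟩
  rw [mul_assoc]
  exact mul_le_mul_of_nonneg_left hFv sphereConst_nonneg

/-! ### The regularized momentum integral -/

/-- The regularized mode density for the potential with derivative `v`. -/
def wickDensity (t₀ μ : ℝ) (v : ℝ → ℝ) (τ : ℝ) (k : EuclideanSpace ℝ (Fin 3)) : ℝ :=
  modeDeviation t₀ (dispersion μ ‖k‖) v τ + primitive t₀ v τ / (4 * dispersion μ ‖k‖ ^ 3)

/-- The integral of the regularized mode density over the momenta. -/
def wickIntegral (t₀ μ : ℝ) (v : ℝ → ℝ) (τ : ℝ) : ℝ := ∫ k, wickDensity t₀ μ v τ k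

/-- Joint measurability makes the momentum integral measurable in time. With the uniform bounds this
suffices to integrate f(H), and continuity in time is not needed. -/
theorem measurable_wickDensity {μ : ℝ} (hμ : 0 < μ) (t₀ : ℝ) {v : ℝ → ℝ} (hv : Continuous v) :
    Measurable fun q : EuclideanSpace ℝ (Fin 3) × ℝ => wickDensity t₀ μ v q.2 q.1 := by
  have hV := continuous_primitive t₀ hv
  have hω : Continuous fun k : EuclideanSpace ℝ (Fin 3) => dispersion μ ‖k‖ :=
    (continuous_dispersion μ).comp continuous_norm
  have hpos : ∀ k : EuclideanSpace ℝ (Fin 3), 0 < dispersion μ ‖k‖ := fun k => dispersion_pos hμ _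
  have hterm : ∀ n, Measurable fun q : EuclideanSpace ℝ (Fin 3) × ℝ =>
      dysonTerm t₀ (dispersion μ ‖q.1‖) (primitive t₀ v) n q.2 := fun n =>
    (continuous_dysonTerm hω hpos t₀ hV n).measurable
  have hsum : Measurable fun q : EuclideanSpace ℝ (Fin 3) × ℝ =>
      dysonSum t₀ (dispersion μ ‖q.1‖) (primitive t₀ v) q.2 := by
    refine measurable_of_tendsto_metrizable
      (f := fun N q => ∑ n ∈ Finset.range N,
        dysonTerm t₀ (dispersion μ ‖q.1‖) (primitive t₀ v) n q.2)
      (fun N => Finset.measurable_fun_sum _ fun n _ => hterm n)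
      (tendsto_pi_nhds.2 fun q => ?_)
    exact (summable_dysonTerm (hpos q.1) t₀ hV q.2).hasSum.tendsto_sum_nat
  have hm : Measurable fun q : EuclideanSpace ℝ (Fin 3) × ℝ => dispersion μ ‖q.1‖ :=
    (hω.comp continuous_fst).measurable
  exact ((hsum.norm.pow_const 2).sub (measurable_const.div (hm.const_mul 2))).add
    ((hV.measurable.comp measurable_snd).div ((hm.pow_const 3).const_mul 4))

theorem measurable_wickIntegral {μ : ℝ} (hμ : 0 < μ) (t₀ : ℝ) {v : ℝ → ℝ} (hv : Continuous v) :
    Measurable (wickIntegral t₀ μ v) :=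
  (measurable_wickDensity hμ t₀ hv).stronglyMeasurable.integral_prod_left'.measurable

theorem wickDensity_zero {μ : ℝ} (hμ : 0 < μ) (t₀ τ : ℝ) (k : EuclideanSpace ℝ (Fin 3)) :
    wickDensity t₀ μ (fun _ => 0) τ k = 0 := by
  simp [wickDensity, modeDeviation_zero (dispersion_pos hμ _)]

theorem wickDensity_eq {μ : ℝ} (hμ : 0 < μ) (t₀ : ℝ) {v : ℝ → ℝ} (hv : Continuous v) (τ : ℝ)
    (k : EuclideanSpace ℝ (Fin 3)) : wickDensity t₀ μ v τ k =
      cosTransform t₀ v τ (dispersion μ ‖k‖) / (4 * dispersion μ ‖k‖ ^ 3) +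
        modeRemainder t₀ (dispersion μ ‖k‖) v τ :=
  modeDeviation_eq (dispersion_pos hμ _) t₀ hv τ

theorem integrable_wickDensity {μ : ℝ} (hμ : 0 < μ) {t₀ τ : ℝ} (hτ : t₀ ≤ τ) {v : ℝ → ℝ}
    (hv : Continuous v) : Integrable (wickDensity t₀ μ v τ) := by
  obtain ⟨M, hM⟩ := isCompact_Icc.exists_bound_of_continuousOn (s := Icc t₀ τ) hv.continuousOn
  have hM0 : 0 ≤ M := (norm_nonneg _).trans (hM _ (left_mem_Icc.2 hτ))
  obtain ⟨C, hC0, hC⟩ := exists_abs_modeRemainder_sub_le (M := M) hμ hM0 (sub_nonneg.2 hτ)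
  obtain ⟨C', hC'0, hC'⟩ := exists_integral_cosTransform_le hμ (sub_nonneg.2 hτ)
  obtain ⟨h1, -⟩ := hC' t₀ τ hτ le_rfl v hv M hM
  have hmeas : AEStronglyMeasurable (wickDensity t₀ μ v τ) :=
    ((measurable_wickDensity hμ t₀ hv).comp
      (measurable_id.prodMk measurable_const)).aestronglyMeasurable
  refine Integrable.mono' (h1.abs.add
    ((integrable_dispersion_pow_neg_four hμ).const_mul (C * M))) hmeas (.of_forall fun k => ?_)
  rw [wickDensity_eq hμ t₀ hv]
  have h2 := hC _ (le_dispersion ‖k‖) t₀ τ hτ le_rfl v (fun _ => 0) hv continuous_const hM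
    (fun _ _ => by simpa using hM0) M (by simpa using hM)
  rw [modeRemainder_zero, sub_zero] at h2
  refine (norm_add_le _ _).trans (add_le_add le_rfl (h2.trans (le_of_eq ?_)))
  ring

/-- The cosine transform is linear in v, so its bound applies directly to v - w; the remainders
differ by O(D κ⁻⁴). -/
theorem exists_abs_wickIntegral_sub_le {μ M L : ℝ} (hμ : 0 < μ) (hM : 0 ≤ M) (hL : 0 ≤ L) :
    ∃ C, 0 ≤ C ∧ ∀ t₀ τ, t₀ ≤ τ → τ - t₀ ≤ L → ∀ v w : ℝ → ℝ, Continuous v → Continuous w →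
      (∀ η ∈ Icc t₀ τ, |v η| ≤ M) → (∀ η ∈ Icc t₀ τ, |w η| ≤ M) →
      ∀ D, (∀ η ∈ Icc t₀ τ, |v η - w η| ≤ D) →
        |wickIntegral t₀ μ v τ - wickIntegral t₀ μ w τ| ≤ C * D := by
  obtain ⟨C, hC0, hC⟩ := exists_abs_modeRemainder_sub_le hμ hM hL
  obtain ⟨C', hC'0, hC'⟩ := exists_integral_cosTransform_le hμ hL
  set S := ∫ k : EuclideanSpace ℝ (Fin 3), 1 / dispersion μ ‖k‖ ^ 4 with hS
  have hS0 : 0 ≤ S := integral_nonneg fun _ => by positivity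
  refine ⟨C' + C * S, by positivity, ?_⟩
  intro t₀ τ hτ hτL v w hv hw hvM hwM D hD
  obtain ⟨h1, h2⟩ := hC' t₀ τ hτ hτL (fun η => v η - w η) (hv.sub hw) D hD
  have h3 := (integrable_dispersion_pow_neg_four hμ).const_mul (C * D)
  unfold wickIntegral
  rw [← integral_sub (integrable_wickDensity hμ hτ hv) (integrable_wickDensity hμ hτ hw)]
  calc _ ≤ ∫ k : EuclideanSpace ℝ (Fin 3),
        (|cosTransform t₀ (fun η => v η - w η) τ (dispersion μ ‖k‖) / (4 * dispersion μ ‖k‖ ^ 3)| +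
          C * D * (1 / dispersion μ ‖k‖ ^ 4)) := by
        rw [← Real.norm_eq_abs]
        refine norm_integral_le_of_norm_le (h1.abs.add h3) (.of_forall fun k => ?_)
        rw [wickDensity_eq hμ t₀ hv, wickDensity_eq hμ t₀ hw, cosTransform_sub t₀ hv hw]
        have h4 := hC _ (le_dispersion ‖k‖) t₀ τ hτ hτL v w hv hw hvM hwM D hD
        rw [add_sub_add_comm, ← sub_div]
        refine (norm_add_le _ _).trans (add_le_add le_rfl (h4.trans (le_of_eq ?_)))
        ring
    _ ≤ C' * D + C * D * S := by
        rw [integral_add h1.abs h3, integral_const_mul]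
        gcongr
    _ = _ := by ring

/-! ### The integrand f(H) in terms of a₀/a, H and the momentum integral -/

namespace FriedmannData

variable {p : FriedmannData}

/-- The quotient `a₀ / a(H)`. -/
def inverseScale (p : FriedmannData) (H : ℝ → ℝ) (τ : ℝ) : ℝ := 1 - p.a₀ * ∫ η in p.τ₀..τ, H η

/-- The integrand of the Friedmann equation in terms of the inverse scale `q`, the Hubble rate `h`
and the regularized momentum integral `J`. -/
def pointwiseRhs (p : FriedmannData) (q h J : ℝ) : ℝ :=
  p.a₀ * q⁻¹ / (p.Hc ^ 2 - h ^ 2) *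
    (h ^ 4 - 2 * p.Hc ^ 2 * h ^ 2 - 15 / 2 * p.m ^ 4 +
      240 * π ^ 2 * (p.m ^ 2 * (q ^ 2 / ((2 * π) ^ 3 * p.a₀ ^ 2) * J + p.m ^ 2 / (4 * π) ^ 2 *
        (1 / 2 - q ^ 2 + 2 * log q +
          2 * log (exp eulerMascheroniConstant * p.m * p.ℓ / √2))) + 4 * p.Lam))

/-- The derivative of the potential in terms of the inverse scale and the Hubble rate. -/
def potentialRate (p : FriedmannData) (q h : ℝ) : ℝ := 2 * p.m ^ 2 * p.a₀ ^ 3 * h / q ^ 3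

theorem freq_eq (k : ℝ) : p.freq k = dispersion (p.a₀ * p.m) k := by
  rw [freq, dispersion, mul_pow]

theorem partialMode_eq_dysonTerm (H : ℝ → ℝ) (k : ℝ) (n : ℕ) :
    p.partialMode H k n = dysonTerm p.τ₀ (p.freq k) (p.potential H) n := by
  induction n with
  | zero => rfl
  | succ n ih =>
    funext τ
    simp only [partialMode, dysonTerm, ih]

section Congr

variable {H : ℝ → ℝ} {v : ℝ → ℝ} {τ₁ : ℝ}

theorem partialMode_eq (h : EqOn (p.potential H) (primitive p.τ₀ v) (Icc p.τ₀ τ₁)) (k : ℝ) (n : ℕ)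
    {τ : ℝ} (hτ : τ ∈ Icc p.τ₀ τ₁) :
    p.partialMode H k n τ = dysonTerm p.τ₀ (p.freq k) (primitive p.τ₀ v) n τ := by
  rw [partialMode_eq_dysonTerm, dysonTerm_congr h n hτ]

theorem wickIntegrand_eq (h : EqOn (p.potential H) (primitive p.τ₀ v) (Icc p.τ₀ τ₁))
    {τ : ℝ} (hτ : τ ∈ Icc p.τ₀ τ₁) :
    p.wickIntegrand H τ = wickDensity p.τ₀ (p.a₀ * p.m) v τ := by
  funext k
  simp only [wickIntegrand, wickDensity, modeDeviation, mode, dysonSum, partialMode_eq h _ _ hτ,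
    h hτ, freq_eq]

theorem rhs_eq (ha₀ : 0 < p.a₀) (h : EqOn (p.potential H) (primitive p.τ₀ v) (Icc p.τ₀ τ₁))
    {τ : ℝ} (hτ : τ ∈ Icc p.τ₀ τ₁) :
    p.rhs H τ = p.pointwiseRhs (p.inverseScale H τ) (H τ)
      (wickIntegral p.τ₀ (p.a₀ * p.m) v τ) := by
  have hq : p.scaleFactor H τ = p.a₀ * (p.inverseScale H τ)⁻¹ := rfl
  have hdiv : p.a₀ / (p.a₀ * (p.inverseScale H τ)⁻¹) = p.inverseScale H τ := by
    rw [div_mul_eq_div_div, div_self ha₀.ne', one_div, inv_inv]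
  have hJ : 1 / ((2 * π) ^ 3 * (p.a₀ * (p.inverseScale H τ)⁻¹) ^ 2) =
      p.inverseScale H τ ^ 2 / ((2 * π) ^ 3 * p.a₀ ^ 2) := by
    rw [mul_pow p.a₀, inv_pow, one_div, ← mul_assoc, mul_inv, inv_inv, mul_comm, div_eq_mul_inv]
  unfold rhs pointwiseRhs wickSquare wickIntegral
  rw [wickIntegrand_eq h hτ, hq, hdiv, hJ]

end Congr

/-- This and the next congruences express causality: at time τ only the values of H on [τ₀, τ]
matter. They allow H to be replaced by a continuous function on the whole line. -/
theorem inverseScale_congr {H H' : ℝ → ℝ} {τ₁ : ℝ} (h : EqOn H H' (Icc p.τ₀ τ₁)) :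
    EqOn (p.inverseScale H) (p.inverseScale H') (Icc p.τ₀ τ₁) := by
  intro τ hτ
  unfold inverseScale
  rw [intervalIntegral.integral_congr (g := H') fun η hη => ?_]
  rw [uIcc_of_le hτ.1] at hη
  exact h ⟨hη.1, hη.2.trans hτ.2⟩

theorem scaleFactor_congr {H H' : ℝ → ℝ} {τ₁ : ℝ} (h : EqOn H H' (Icc p.τ₀ τ₁)) :
    EqOn (p.scaleFactor H) (p.scaleFactor H') (Icc p.τ₀ τ₁) := fun τ hτ => by
  have := inverseScale_congr (p := p) h hτ
  unfold inverseScale at this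
  unfold scaleFactor
  rw [this]

theorem potential_congr {H H' : ℝ → ℝ} {τ₁ : ℝ} (h : EqOn H H' (Icc p.τ₀ τ₁)) :
    EqOn (p.potential H) (p.potential H') (Icc p.τ₀ τ₁) := fun τ hτ => by
  unfold potential
  rw [scaleFactor_congr h hτ]

theorem wickIntegrand_congr {H H' : ℝ → ℝ} {τ₁ : ℝ} (h : EqOn H H' (Icc p.τ₀ τ₁)) :
    EqOn (p.wickIntegrand H) (p.wickIntegrand H') (Icc p.τ₀ τ₁) := fun τ hτ => by
  funext k
  have h1 : ∀ n, p.partialMode H ‖k‖ n τ = p.partialMode H' ‖k‖ n τ := fun n => by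
    rw [partialMode_eq_dysonTerm, partialMode_eq_dysonTerm,
      dysonTerm_congr (potential_congr h) n hτ]
  simp only [wickIntegrand, mode, h1, potential_congr h hτ]

theorem rhs_congr {H H' : ℝ → ℝ} {τ₁ : ℝ} (h : EqOn H H' (Icc p.τ₀ τ₁)) :
    EqOn (p.rhs H) (p.rhs H') (Icc p.τ₀ τ₁) := fun τ hτ => by
  unfold rhs wickSquare
  rw [scaleFactor_congr h hτ, wickIntegrand_congr h hτ, h hτ]

/-! ### The truncated equation -/

/-- The truncation of `x` to the interval `[-h, h]`. -/
def clip (h x : ℝ) : ℝ := max (-h) (min x h)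

theorem continuous_clip (h : ℝ) : Continuous (clip h) := by unfold clip; fun_prop

theorem abs_clip_le {h : ℝ} (hh : 0 ≤ h) (x : ℝ) : |clip h x| ≤ h :=
  abs_le.2 ⟨le_max_left _ _, max_le (by linarith) (min_le_right _ _)⟩

theorem clip_eq_self {h x : ℝ} (hx : |x| ≤ h) : clip h x = x := by
  rw [clip, min_eq_left (abs_le.1 hx).2, max_eq_right (abs_le.1 hx).1]

theorem abs_clip_sub_clip_le (h x y : ℝ) : |clip h x - clip h y| ≤ |x - y| := by
  refine (abs_max_sub_max_le_max _ _ _ _).trans (max_le (by simp) ?_)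
  exact (abs_min_sub_min_le_max _ _ _ _).trans (by simp)

/-- The inverse scale of the truncated Hubble rate, bounded below by `δ`. -/
def cutScale (p : FriedmannData) (h δ : ℝ) (H : ℝ → ℝ) (τ : ℝ) : ℝ :=
  max (1 - p.a₀ * primitive p.τ₀ (fun η => clip h (H η)) τ) δ

/-- The derivative of the potential of the truncated problem. -/
def cutRate (p : FriedmannData) (h δ : ℝ) (H : ℝ → ℝ) (τ : ℝ) : ℝ :=
  p.potentialRate (p.cutScale h δ H τ) (clip h (H τ))

/-- The integrand of the truncated Friedmann equation. -/
def cutRhs (p : FriedmannData) (h δ : ℝ) (H : ℝ → ℝ) (τ : ℝ) : ℝ :=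
  p.pointwiseRhs (p.cutScale h δ H τ) (clip h (H τ))
    (wickIntegral p.τ₀ (p.a₀ * p.m) (p.cutRate h δ H) τ)

theorem continuous_cutScale (h δ : ℝ) {H : ℝ → ℝ} (hH : Continuous H) :
    Continuous (p.cutScale h δ H) :=
  (continuous_const.sub (continuous_const.mul
    (continuous_primitive _ ((continuous_clip h).comp hH)))).max continuous_const

theorem cutScale_pos {h δ : ℝ} (hδ : 0 < δ) (H : ℝ → ℝ) (τ : ℝ) : 0 < p.cutScale h δ H τ :=
  hδ.trans_le (le_max_right _ _)

theorem continuous_cutRate (h : ℝ) {δ : ℝ} (hδ : 0 < δ) {H : ℝ → ℝ} (hH : Continuous H) :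
    Continuous (p.cutRate h δ H) :=
  (continuous_const.mul ((continuous_clip h).comp hH)).div ((continuous_cutScale h δ hH).pow 3)
    fun τ => (pow_pos (cutScale_pos hδ H τ) 3).ne'

theorem measurable_cutRhs (hm : 0 < p.m) (ha₀ : 0 < p.a₀) (h : ℝ) {δ : ℝ} (hδ : 0 < δ) {H : ℝ → ℝ}
    (hH : Continuous H) : Measurable (p.cutRhs h δ H) := by
  have h1 := (continuous_cutScale (p := p) h δ hH).measurable
  have h2 := ((continuous_clip h).comp hH).measurable
  have h3 := measurable_wickIntegral (mul_pos ha₀ hm) p.τ₀ (continuous_cutRate (p := p) h hδ hH)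
  simp only [Function.comp_def] at h2
  unfold cutRhs pointwiseRhs
  fun_prop

theorem cutScale_eq {h δ : ℝ} {H : ℝ → ℝ} {τ₁ : ℝ} (hh : ∀ τ ∈ Icc p.τ₀ τ₁, |H τ| ≤ h)
    (hδ : ∀ τ ∈ Icc p.τ₀ τ₁, δ ≤ p.inverseScale H τ) :
    EqOn (p.cutScale h δ H) (p.inverseScale H) (Icc p.τ₀ τ₁) := fun τ hτ => by
  have h1 : EqOn (fun η => clip h (H η)) H (Icc p.τ₀ τ₁) := fun η hη => clip_eq_self (hh η hη)
  have h2 := inverseScale_congr h1 hτ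
  change max (p.inverseScale (fun η => clip h (H η)) τ) δ = _
  rw [h2, max_eq_left (hδ τ hτ)]

/-- With q = a₀/a one has V = m²a₀²(q⁻² - 1) and q' = -a₀H. Where the truncation is inactive, V' is
therefore a function of q and H alone. -/
theorem potential_eq_primitive_cutRate {h δ : ℝ} (hδ0 : 0 < δ) {H : ℝ → ℝ} (hH : Continuous H)
    {τ₁ : ℝ} (hh : ∀ τ ∈ Icc p.τ₀ τ₁, |H τ| ≤ h)
    (hδ : ∀ τ ∈ Icc p.τ₀ τ₁, δ ≤ p.inverseScale H τ) :
    EqOn (p.potential H) (primitive p.τ₀ (p.cutRate h δ H)) (Icc p.τ₀ τ₁) := fun τ hτ => by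
  have hq : ∀ η, HasDerivAt (p.inverseScale H) (-(p.a₀ * H η)) η := fun η =>
    ((hasDerivAt_primitive p.τ₀ hH η).const_mul p.a₀).const_sub 1
  have hd : ∀ η ∈ uIcc p.τ₀ τ, HasDerivAt (fun η => p.m ^ 2 * p.a₀ ^ 2 * (p.inverseScale H η ^ 2)⁻¹)
      (p.cutRate h δ H η) η := fun η hη => by
    rw [uIcc_of_le hτ.1] at hη
    have hη' : η ∈ Icc p.τ₀ τ₁ := ⟨hη.1, hη.2.trans hτ.2⟩
    have hpos : p.inverseScale H η ≠ 0 := (hδ0.trans_le (hδ η hη')).ne'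
    refine ((((hq η).pow 2).inv (pow_ne_zero 2 hpos)).const_mul
      (p.m ^ 2 * p.a₀ ^ 2)).congr_deriv ?_
    rw [cutRate, cutScale_eq hh hδ hη', clip_eq_self (hh η hη'), potentialRate]
    simp only [Pi.pow_apply]
    field_simp
    norm_num
    ring
  have hI := intervalIntegral.integral_eq_sub_of_hasDerivAt hd
    ((continuous_cutRate h hδ0 hH).intervalIntegrable _ _)
  rw [primitive, hI]
  have h0 : p.inverseScale H p.τ₀ = 1 := by simp [inverseScale]
  have hs : p.scaleFactor H τ = p.a₀ * (p.inverseScale H τ)⁻¹ := rfl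
  rw [h0, potential, hs]
  ring

theorem rhs_eq_cutRhs (ha₀ : 0 < p.a₀) {h δ : ℝ} (hδ0 : 0 < δ) {H : ℝ → ℝ} (hH : Continuous H)
    {τ₁ : ℝ} (hh : ∀ τ ∈ Icc p.τ₀ τ₁, |H τ| ≤ h)
    (hδ : ∀ τ ∈ Icc p.τ₀ τ₁, δ ≤ p.inverseScale H τ) :
    EqOn (p.rhs H) (p.cutRhs h δ H) (Icc p.τ₀ τ₁) := fun τ hτ => by
  rw [rhs_eq ha₀ (potential_eq_primitive_cutRate hδ0 hH hh hδ) hτ, cutRhs,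
    cutScale_eq hh hδ hτ, clip_eq_self (hh τ hτ)]

theorem cutScale_mem_Icc (ha₀ : 0 < p.a₀) {h δ L : ℝ} (hh : 0 ≤ h) (H : ℝ → ℝ) {τ : ℝ}
    (hτ : p.τ₀ ≤ τ) (hL : τ - p.τ₀ ≤ L) :
    p.cutScale h δ H τ ∈ Icc δ (max (1 + p.a₀ * (h * L)) δ) := by
  refine ⟨le_max_right _ _, max_le_max_right _ ?_⟩
  have h1 := (abs_le.1 (abs_primitive_le hτ (v := fun η => clip h (H η))
    fun η _ => abs_clip_le hh _)).1
  have h2 : h * (τ - p.τ₀) ≤ h * L := by gcongr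
  nlinarith

theorem abs_cutScale_sub_le (ha₀ : 0 < p.a₀) {h δ L D : ℝ} {H H' : ℝ → ℝ} (hH : Continuous H)
    (hH' : Continuous H') {τ : ℝ} (hτ : p.τ₀ ≤ τ) (hL : τ - p.τ₀ ≤ L)
    (hD : ∀ η ∈ Icc p.τ₀ τ, |H η - H' η| ≤ D) :
    |p.cutScale h δ H τ - p.cutScale h δ H' τ| ≤ p.a₀ * L * D := by
  have hD0 : 0 ≤ D := (abs_nonneg _).trans (hD _ (left_mem_Icc.2 hτ))
  refine (abs_max_sub_max_le_abs _ _ _).trans ?_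
  rw [sub_sub_sub_cancel_left, ← mul_sub, abs_mul, abs_of_pos ha₀, abs_sub_comm, mul_assoc]
  have hc := (continuous_clip h).comp hH
  have hc' := (continuous_clip h).comp hH'
  have h1 := primitive_sub p.τ₀ hc hc' τ
  simp only [Function.comp_def] at h1
  rw [← h1]
  refine mul_le_mul_of_nonneg_left ?_ ha₀.le
  refine (abs_primitive_le hτ fun η hη => (abs_clip_sub_clip_le h _ _).trans (hD η hη)).trans ?_
  rw [mul_comm]
  gcongr

end FriedmannData

/-! ### Lipschitz bounds for the truncated integrand -/

theorem LipschitzOnWith.abs_sub_le_mul {X : Type*} [PseudoMetricSpace X] {f : X → ℝ}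
    {s : Set X} {K : NNReal} (hf : LipschitzOnWith K f s) {x y : X} (hx : x ∈ s) (hy : y ∈ s)
    {d : ℝ} (hd : dist x y ≤ d) : |f x - f y| ≤ K * d := by
  rw [← Real.dist_eq]
  exact (hf.dist_le_mul x hx y hy).trans (by gcongr)

namespace FriedmannData

variable {p : FriedmannData}

theorem exists_lipschitzOnWith_potentialRate {δ : ℝ} (hδ : 0 < δ) (Q h : ℝ) :
    ∃ K, LipschitzOnWith K (fun x : ℝ × ℝ => p.potentialRate x.1 x.2)
      (Icc δ Q ×ˢ Icc (-h) h) := by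
  refine ContDiffOn.exists_lipschitzOnWith (n := 1) (fun x hx => ?_) one_ne_zero
    ((convex_Icc _ _).prod (convex_Icc _ _)) (isCompact_Icc.prod isCompact_Icc)
  have hq : x.1 ^ 3 ≠ 0 := (pow_pos (hδ.trans_le hx.1.1) 3).ne'
  unfold potentialRate
  refine ContDiffAt.contDiffWithinAt ?_
  fun_prop (disch := assumption)

/-- On this compact convex box the function is continuously differentiable: `δ` keeps q away from
the singularities of q⁻¹ and log q, and `h < p.Hc` keeps the denominator positive. -/
theorem exists_lipschitzOnWith_pointwiseRhs {δ : ℝ} (hδ : 0 < δ) (Q : ℝ) {h : ℝ} (hh : h < p.Hc)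
    (B : ℝ) :
    ∃ K, LipschitzOnWith K (fun x : ℝ × ℝ × ℝ => p.pointwiseRhs x.1 x.2.1 x.2.2)
      (Icc δ Q ×ˢ Icc (-h) h ×ˢ Icc (-B) B) := by
  refine ContDiffOn.exists_lipschitzOnWith (n := 1) (fun x hx => ?_) one_ne_zero
    ((convex_Icc _ _).prod ((convex_Icc _ _).prod (convex_Icc _ _)))
    (isCompact_Icc.prod (isCompact_Icc.prod isCompact_Icc))
  have hq : x.1 ≠ 0 := (hδ.trans_le hx.1.1).ne'
  have hd : p.Hc ^ 2 - x.2.1 ^ 2 ≠ 0 := by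
    have h1 : x.2.1 ^ 2 ≤ h ^ 2 := sq_le_sq' hx.2.1.1 hx.2.1.2
    have h2 : h ^ 2 < p.Hc ^ 2 := by nlinarith [hx.2.1.1, hx.2.1.2]
    exact (by linarith : 0 < p.Hc ^ 2 - x.2.1 ^ 2).ne'
  unfold pointwiseRhs
  refine ContDiffAt.contDiffWithinAt ?_
  fun_prop (disch := assumption)

theorem exists_cutRate_bounds (ha₀ : 0 < p.a₀) {h δ L : ℝ} (hh : 0 ≤ h) (hδ : 0 < δ)
    (hL : 0 ≤ L) : ∃ M K, 0 ≤ M ∧ 0 ≤ K ∧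
      (∀ H : ℝ → ℝ, ∀ τ, p.τ₀ ≤ τ → τ - p.τ₀ ≤ L → |p.cutRate h δ H τ| ≤ M) ∧
      ∀ H H' : ℝ → ℝ, Continuous H → Continuous H' → ∀ τ, p.τ₀ ≤ τ → τ - p.τ₀ ≤ L →
        ∀ D, (∀ η ∈ Icc p.τ₀ τ, |H η - H' η| ≤ D) →
          |p.cutRate h δ H τ - p.cutRate h δ H' τ| ≤ K * D := by
  set Q := max (1 + p.a₀ * (h * L)) δ with hQ
  obtain ⟨K, hK⟩ := exists_lipschitzOnWith_potentialRate (p := p) hδ Q h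
  have hmem : ∀ H : ℝ → ℝ, ∀ τ, p.τ₀ ≤ τ → τ - p.τ₀ ≤ L →
      (p.cutScale h δ H τ, clip h (H τ)) ∈ Icc δ Q ×ˢ Icc (-h) h := fun H τ h1 h2 =>
    ⟨cutScale_mem_Icc ha₀ hh H h1 h2, abs_le.1 (abs_clip_le hh _)⟩
  obtain ⟨M, hM⟩ := (isCompact_Icc.prod isCompact_Icc).exists_bound_of_continuousOn hK.continuousOn
  refine ⟨|M|, K * (p.a₀ * L + 1), abs_nonneg _, by positivity,
    fun H τ h1 h2 => (hM _ (hmem H τ h1 h2)).trans (le_abs_self M), ?_⟩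
  intro H H' hH hH' τ h1 h2 D hD
  have hD0 : 0 ≤ D := (abs_nonneg _).trans (hD _ (left_mem_Icc.2 h1))
  rw [mul_assoc]
  refine hK.abs_sub_le_mul (hmem H τ h1 h2) (hmem H' τ h1 h2) (max_le ?_ ?_)
  · refine (abs_cutScale_sub_le ha₀ hH hH' h1 h2 hD).trans ?_
    linarith
  · refine ((abs_clip_sub_clip_le h _ _).trans (hD τ (right_mem_Icc.2 h1))).trans ?_
    have : 0 ≤ p.a₀ * L * D := by positivity
    linarith

theorem exists_wickIntegral_cutRate_bounds (hm : 0 < p.m) (ha₀ : 0 < p.a₀) {h δ L : ℝ}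
    (hh : 0 ≤ h) (hδ : 0 < δ) (hL : 0 ≤ L) : ∃ B K, 0 ≤ B ∧ 0 ≤ K ∧
      (∀ H : ℝ → ℝ, Continuous H → ∀ τ, p.τ₀ ≤ τ → τ - p.τ₀ ≤ L →
        |wickIntegral p.τ₀ (p.a₀ * p.m) (p.cutRate h δ H) τ| ≤ B) ∧
      ∀ H H' : ℝ → ℝ, Continuous H → Continuous H' → ∀ τ, p.τ₀ ≤ τ → τ - p.τ₀ ≤ L →
        ∀ D, (∀ η ∈ Icc p.τ₀ τ, |H η - H' η| ≤ D) →
          |wickIntegral p.τ₀ (p.a₀ * p.m) (p.cutRate h δ H) τ -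
            wickIntegral p.τ₀ (p.a₀ * p.m) (p.cutRate h δ H') τ| ≤ K * D := by
  have hμ : 0 < p.a₀ * p.m := mul_pos ha₀ hm
  obtain ⟨M, K, hM0, hK0, hM, hK⟩ := exists_cutRate_bounds ha₀ hh hδ hL
  obtain ⟨C, hC0, hC⟩ := exists_abs_wickIntegral_sub_le hμ hM0 hL
  refine ⟨C * M, C * K, by positivity, by positivity, fun H hH τ h1 h2 => ?_,
    fun H H' hH hH' τ h1 h2 D hD => ?_⟩
  · have hb : ∀ η ∈ Icc p.τ₀ τ, |p.cutRate h δ H η| ≤ M := fun η hη =>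
      hM H η hη.1 (by linarith [hη.2])
    -- Boundedness is the Lipschitz estimate against the zero potential, whose momentum integral
    -- vanishes.
    have := hC p.τ₀ τ h1 h2 _ (fun _ => 0) (continuous_cutRate h hδ hH) continuous_const hb
      (by simpa using fun _ _ _ => hM0) M (by simpa using hb)
    have h0 : wickIntegral p.τ₀ (p.a₀ * p.m) (fun _ => 0) τ = 0 := by
      simp [wickIntegral, wickDensity_zero hμ]
    rwa [h0, sub_zero] at this
  · rw [mul_assoc]
    refine hC p.τ₀ τ h1 h2 _ _ (continuous_cutRate h hδ hH) (continuous_cutRate h hδ hH')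
      (fun η hη => hM H η hη.1 (by linarith [hη.2]))
      (fun η hη => hM H' η hη.1 (by linarith [hη.2])) _ fun η hη => ?_
    exact hK H H' hH hH' η hη.1 (by linarith [hη.2]) D fun ζ hζ => hD ζ ⟨hζ.1, hζ.2.trans hη.2⟩

theorem exists_cutRhs_bounds (hm : 0 < p.m) (ha₀ : 0 < p.a₀) {h δ L : ℝ}
    (hh : 0 ≤ h) (hhc : h < p.Hc) (hδ : 0 < δ) (hL : 0 ≤ L) : ∃ B K, 0 ≤ K ∧
      (∀ H : ℝ → ℝ, Continuous H → ∀ τ, p.τ₀ ≤ τ → τ - p.τ₀ ≤ L → |p.cutRhs h δ H τ| ≤ B) ∧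
      ∀ H H' : ℝ → ℝ, Continuous H → Continuous H' → ∀ τ, p.τ₀ ≤ τ → τ - p.τ₀ ≤ L →
        ∀ D, (∀ η ∈ Icc p.τ₀ τ, |H η - H' η| ≤ D) →
          |p.cutRhs h δ H τ - p.cutRhs h δ H' τ| ≤ K * D := by
  set Q := max (1 + p.a₀ * (h * L)) δ with hQ
  obtain ⟨J, C, hJ0, hC0, hJ, hC⟩ := exists_wickIntegral_cutRate_bounds hm ha₀ hh hδ hL
  obtain ⟨K, hK⟩ := exists_lipschitzOnWith_pointwiseRhs (p := p) hδ Q hhc J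
  have hmem : ∀ H : ℝ → ℝ, Continuous H → ∀ τ, p.τ₀ ≤ τ → τ - p.τ₀ ≤ L →
      (p.cutScale h δ H τ, clip h (H τ), wickIntegral p.τ₀ (p.a₀ * p.m) (p.cutRate h δ H) τ) ∈
        Icc δ Q ×ˢ Icc (-h) h ×ˢ Icc (-J) J := fun H hH τ h1 h2 =>
    ⟨cutScale_mem_Icc ha₀ hh H h1 h2, abs_le.1 (abs_clip_le hh _), abs_le.1 (hJ H hH τ h1 h2)⟩
  obtain ⟨B, hB⟩ := (isCompact_Icc.prod
    (isCompact_Icc.prod isCompact_Icc)).exists_bound_of_continuousOn hK.continuousOn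
  -- The sum dominates each of the three component distances, hence the distance in the product.
  refine ⟨B, K * (p.a₀ * L + 1 + C), by positivity,
    fun H hH τ h1 h2 => hB _ (hmem H hH τ h1 h2), ?_⟩
  intro H H' hH hH' τ h1 h2 D hD
  have hD0 : 0 ≤ D := (abs_nonneg _).trans (hD _ (left_mem_Icc.2 h1))
  have hL' : 0 ≤ p.a₀ * L * D := by positivity
  have hC' : 0 ≤ C * D := by positivity
  rw [mul_assoc]
  refine hK.abs_sub_le_mul (hmem H hH τ h1 h2) (hmem H' hH' τ h1 h2)
    (max_le ?_ (max_le ?_ ?_))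
  · refine (abs_cutScale_sub_le ha₀ hH hH' h1 h2 hD).trans ?_
    linarith
  · refine ((abs_clip_sub_clip_le h _ _).trans (hD τ (right_mem_Icc.2 h1))).trans ?_
    linarith
  · refine (hC H H' hH hH' τ h1 h2 D hD).trans ?_
    linarith

/-- As long as `a(H)` stays bounded, `f(H)` is bounded wherever `H` stays away from `± H_c`. -/
theorem exists_rhs_bound (hm : 0 < p.m) (ha₀ : 0 < p.a₀) {h δ L : ℝ}
    (hh : h < p.Hc) (hδ : 0 < δ) (hL : 0 ≤ L) : ∃ B, ∀ H : ℝ → ℝ, Continuous H →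
      ∀ τ, p.τ₀ ≤ τ → τ - p.τ₀ ≤ L → (∀ η ∈ Icc p.τ₀ τ, |H η| ≤ p.Hc) →
        (∀ η ∈ Icc p.τ₀ τ, δ ≤ p.inverseScale H η) → |H τ| ≤ h → |p.rhs H τ| ≤ B := by
  have hc : 0 ≤ p.Hc := Real.sqrt_nonneg _
  set Q := max (1 + p.a₀ * (p.Hc * L)) δ with hQ
  -- The momentum integral is not singular at |H| = H_c, so the history of H may be truncated at H_c
  -- itself. Only the present value of H must stay below `h`.
  obtain ⟨J, -, hJ0, -, hJ, -⟩ := exists_wickIntegral_cutRate_bounds hm ha₀ hc hδ hL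
  obtain ⟨K, hK⟩ := exists_lipschitzOnWith_pointwiseRhs (p := p) hδ Q hh J
  obtain ⟨B, hB⟩ := (isCompact_Icc.prod
    (isCompact_Icc.prod isCompact_Icc)).exists_bound_of_continuousOn hK.continuousOn
  refine ⟨B, fun H hH τ h1 h2 h3 h4 h5 => ?_⟩
  have hτ : τ ∈ Icc p.τ₀ τ := right_mem_Icc.2 h1
  rw [rhs_eq_cutRhs ha₀ hδ hH h3 h4 hτ]
  refine hB (p.cutScale p.Hc δ H τ, clip p.Hc (H τ),
    wickIntegral p.τ₀ (p.a₀ * p.m) (p.cutRate p.Hc δ H) τ)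
    ⟨cutScale_mem_Icc ha₀ hc H h1 h2, ?_, abs_le.1 (hJ H hH τ h1 h2)⟩
  rw [clip_eq_self (h3 τ hτ)]
  exact abs_le.1 h5

end FriedmannData

/-! ### Picard iteration for causal Lipschitz functionals -/

/-- A causal functional that is uniformly Lipschitz and bounded on `[a, b]`. -/
structure IsCausalLipschitz (Φ : (ℝ → ℝ) → ℝ → ℝ) (a b B K : ℝ) : Prop where
  nonneg : 0 ≤ K
  measurable : ∀ H, Continuous H → Measurable (Φ H)
  bound : ∀ H, Continuous H → ∀ τ ∈ Icc a b, |Φ H τ| ≤ B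
  lipschitz : ∀ H H', Continuous H → Continuous H' → ∀ τ ∈ Icc a b, ∀ D,
    (∀ η ∈ Icc a τ, |H η - H' η| ≤ D) → |Φ H τ - Φ H' τ| ≤ K * D

namespace IsCausalLipschitz

variable {Φ : (ℝ → ℝ) → ℝ → ℝ} {a b B K : ℝ}

theorem integrableOn (hΦ : IsCausalLipschitz Φ a b B K) {H : ℝ → ℝ} (hH : Continuous H) :
    IntegrableOn (Φ H) (Icc a b) :=
  Measure.integrableOn_of_bounded (by simp) (hΦ.measurable H hH).aestronglyMeasurable
    ((ae_restrict_iff' measurableSet_Icc).2 (.of_forall fun τ hτ => hΦ.bound H hH τ hτ))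

theorem intervalIntegrable (hΦ : IsCausalLipschitz Φ a b B K) {H : ℝ → ℝ} (hH : Continuous H)
    {τ : ℝ} (hτ : τ ∈ Icc a b) : IntervalIntegrable (Φ H) volume a τ :=
  (intervalIntegrable_iff_integrableOn_Icc_of_le hτ.1).2
    ((hΦ.integrableOn hH).mono_set (Icc_subset_Icc_right hτ.2))

theorem continuousOn_integral (hΦ : IsCausalLipschitz Φ a b B K) (hab : a ≤ b) {H : ℝ → ℝ}
    (hH : Continuous H) : ContinuousOn (fun τ => ∫ η in a..τ, Φ H η) (Icc a b) := by
  have h := hΦ.integrableOn hH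
  rw [← uIcc_of_le hab] at h ⊢
  exact intervalIntegral.continuousOn_primitive_interval h

theorem abs_integral_sub_le (hΦ : IsCausalLipschitz Φ a b B K) {H H' : ℝ → ℝ} (hH : Continuous H)
    (hH' : Continuous H') {t D : ℝ} (ht : t ∈ Icc a b) (hD : 0 ≤ D) (n : ℕ)
    (h : ∀ η ∈ Icc a t, |H η - H' η| ≤ D * ((K * (η - a)) ^ n / n.factorial)) {τ : ℝ}
    (hτ : τ ∈ Icc a t) : |(∫ η in a..τ, Φ H η) - ∫ η in a..τ, Φ H' η| ≤
      D * ((K * (τ - a)) ^ (n + 1) / (n + 1).factorial) := by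
  have hK := hΦ.nonneg
  have hτ' : τ ∈ Icc a b := ⟨hτ.1, hτ.2.trans ht.2⟩
  rw [← intervalIntegral.integral_sub (hΦ.intervalIntegrable hH hτ')
    (hΦ.intervalIntegrable hH' hτ')]
  calc _ ≤ ∫ η in a..τ, K * (D * ((K * (η - a)) ^ n / n.factorial)) := by
        refine abs_integral_le_of_abs_le hτ.1 (by fun_prop) fun η hη => ?_
        -- By causality the bound at η applies to all earlier times, as (K (ζ - a)) ^ n increases
        -- with ζ.
        refine hΦ.lipschitz H H' hH hH' η ⟨hη.1, hη.2.trans hτ'.2⟩ _ fun ζ hζ => ?_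
        refine (h ζ ⟨hζ.1, hζ.2.trans (hη.2.trans hτ.2)⟩).trans ?_
        have h1 : 0 ≤ ζ - a := sub_nonneg.2 hζ.1
        have h2 : ζ - a ≤ η - a := by linarith [hζ.2]
        gcongr
    _ = _ := by
        have hd : ∀ η, HasDerivAt (fun η => D * ((K * (η - a)) ^ (n + 1) / (n + 1).factorial))
            (K * (D * ((K * (η - a)) ^ n / n.factorial))) η := fun η => by
          have h1 : HasDerivAt (fun η => K * (η - a)) K η := by
            simpa using ((hasDerivAt_id η).sub_const a).const_mul K
          refine (((h1.pow (n + 1)).div_const _).const_mul D).congr_deriv ?_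
          rw [Nat.factorial_succ]
          push_cast
          field_simp
        rw [intervalIntegral.integral_eq_sub_of_hasDerivAt (fun η _ => hd η)
          (Continuous.intervalIntegrable (by fun_prop) _ _)]
        simp

theorem eqOn (hΦ : IsCausalLipschitz Φ a b B K) {H H' : ℝ → ℝ} (hH : Continuous H)
    (hH' : Continuous H') {c t : ℝ} (ht : t ∈ Icc a b)
    (h : ∀ τ ∈ Icc a t, H τ = c + ∫ η in a..τ, Φ H η)
    (h' : ∀ τ ∈ Icc a t, H' τ = c + ∫ η in a..τ, Φ H' η) : EqOn H H' (Icc a t) := by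
  obtain ⟨D, hD⟩ := (isCompact_Icc (a := a) (b := t)).exists_bound_of_continuousOn
    (hH.sub hH').continuousOn
  have hD0 : 0 ≤ D := (norm_nonneg _).trans (hD a (left_mem_Icc.2 ht.1))
  have key : ∀ n : ℕ, ∀ τ ∈ Icc a t, |H τ - H' τ| ≤ D * ((K * (τ - a)) ^ n / n.factorial) := by
    intro n
    induction n with
    | zero => intro τ hτ; simpa using hD τ hτ
    | succ n ih =>
      intro τ hτ
      rw [h τ hτ, h' τ hτ, add_sub_add_left_eq_sub]
      exact hΦ.abs_integral_sub_le hH hH' ht hD0 n ih hτ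
  intro τ hτ
  have hlim : Tendsto (fun n : ℕ => D * ((K * (τ - a)) ^ n / n.factorial)) atTop (𝓝 (D * 0)) :=
    (FloorSemiring.tendsto_pow_div_factorial_atTop _).const_mul D
  rw [mul_zero] at hlim
  have h0 := ge_of_tendsto' hlim fun n => key n τ hτ
  exact sub_eq_zero.1 (abs_nonpos_iff.1 h0)

/-- The Picard operator on continuous functions on `[a, b]`. -/
def picard (hΦ : IsCausalLipschitz Φ a b B K) (hab : a ≤ b) (c : ℝ) (u : C(Icc a b, ℝ)) :
    C(Icc a b, ℝ) where
  toFun τ := c + ∫ η in a..τ, Φ (IccExtend hab u) η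
  continuous_toFun := by
    have h := hΦ.continuousOn_integral hab (u.continuous.Icc_extend' (h := hab))
    rw [continuousOn_iff_continuous_domRestrict] at h
    exact continuous_const.add h

theorem abs_picard_iterate_sub_le (hΦ : IsCausalLipschitz Φ a b B K) (hab : a ≤ b) (c : ℝ)
    (u w : C(Icc a b, ℝ)) (n : ℕ) (τ : Icc a b) :
    |(hΦ.picard hab c)^[n] u τ - (hΦ.picard hab c)^[n] w τ| ≤
      dist u w * ((K * (τ - a)) ^ n / n.factorial) := by
  induction n generalizing τ with
  | zero => simpa [← Real.dist_eq] using ContinuousMap.dist_apply_le_dist τ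
  | succ n ih =>
    rw [Function.iterate_succ_apply', Function.iterate_succ_apply']
    set u' := (hΦ.picard hab c)^[n] u
    set w' := (hΦ.picard hab c)^[n] w
    change |(c + ∫ η in a..τ, Φ (IccExtend hab u') η) -
      (c + ∫ η in a..τ, Φ (IccExtend hab w') η)| ≤ _
    rw [add_sub_add_left_eq_sub]
    refine hΦ.abs_integral_sub_le u'.continuous.Icc_extend' w'.continuous.Icc_extend'
      (right_mem_Icc.2 hab) dist_nonneg n (fun η hη => ?_) τ.2
    rw [IccExtend_of_mem hab _ hη, IccExtend_of_mem hab _ hη]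
    exact ih ⟨η, hη⟩

theorem exists_solution (hΦ : IsCausalLipschitz Φ a b B K) (hab : a ≤ b) (c : ℝ) :
    ∃ H : ℝ → ℝ, Continuous H ∧ ∀ τ ∈ Icc a b, H τ = c + ∫ η in a..τ, Φ H η := by
  have hK := hΦ.nonneg
  have hL : 0 ≤ b - a := sub_nonneg.2 hab
  -- Passing to a high iterate gives a contraction on the whole of [a, b], whatever the size of K (b
  -- - a).
  obtain ⟨n, hn⟩ := ((FloorSemiring.tendsto_pow_div_factorial_atTop (K * (b - a))).eventually
    (gt_mem_nhds one_pos)).exists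
  have hq : 0 ≤ (K * (b - a)) ^ n / n.factorial := by
    have := mul_nonneg hK hL
    positivity
  have hcontr : ContractingWith (.mk ((K * (b - a)) ^ n / n.factorial) hq)
      (hΦ.picard hab c)^[n] := by
    refine ⟨by exact_mod_cast hn, LipschitzWith.of_dist_le_mul fun u w => ?_⟩
    refine (ContinuousMap.dist_le (mul_nonneg hq dist_nonneg)).2 fun τ => ?_
    rw [Real.dist_eq]
    refine (hΦ.abs_picard_iterate_sub_le hab c u w n τ).trans ?_
    rw [mul_comm]
    have h1 : 0 ≤ (τ : ℝ) - a := sub_nonneg.2 τ.2.1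
    have h2 : (τ : ℝ) - a ≤ b - a := by linarith [τ.2.2]
    change _ ≤ (K * (b - a)) ^ n / n.factorial * dist u w
    gcongr
  set u := ContractingWith.fixedPoint _ hcontr
  -- The unique fixed point of an iterate is also fixed by the operator itself.
  have hu : hΦ.picard hab c u = u := hcontr.isFixedPt_fixedPoint_iterate
  refine ⟨IccExtend hab u, u.continuous.Icc_extend', fun τ hτ => ?_⟩
  rw [IccExtend_of_mem hab _ hτ]
  conv_lhs => rw [← hu]
  rfl

end IsCausalLipschitz

/-! ### Regular solutions on compact intervals -/

namespace FriedmannData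

variable {p : FriedmannData}

theorem exists_isCausalLipschitz_cutRhs (hm : 0 < p.m) (ha₀ : 0 < p.a₀) {h δ τ₁ : ℝ}
    (hh : 0 ≤ h) (hhc : h < p.Hc) (hδ : 0 < δ) (hτ₁ : p.τ₀ ≤ τ₁) :
    ∃ B K, IsCausalLipschitz (p.cutRhs h δ) p.τ₀ τ₁ B K := by
  obtain ⟨B, K, hK0, hB, hK⟩ := exists_cutRhs_bounds hm ha₀ hh hhc hδ (sub_nonneg.2 hτ₁)
  exact ⟨B, K, hK0, fun H hH => measurable_cutRhs hm ha₀ h hδ hH,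
    fun H hH τ hτ => hB H hH τ hτ.1 (by linarith [hτ.2]),
    fun H H' hH hH' τ hτ => hK H H' hH hH' τ hτ.1 (by linarith [hτ.2])⟩

end FriedmannData

theorem ContinuousOn.exists_continuous_eqOn_Icc {H : ℝ → ℝ} {a b : ℝ} (hab : a ≤ b)
    (hH : ContinuousOn H (Icc a b)) : ∃ G : ℝ → ℝ, Continuous G ∧ EqOn G H (Icc a b) :=
  ⟨IccExtend hab ((Icc a b).domRestrict H), hH.domRestrict.Icc_extend', fun τ hτ => by
    rw [IccExtend_of_mem hab _ hτ]; rfl⟩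

namespace FriedmannData

variable {p : FriedmannData}

theorem inverseScale_pos_iff {H : ℝ → ℝ} {τ : ℝ} :
    0 < p.inverseScale H τ ↔ p.a₀ * (∫ η in p.τ₀..τ, H η) < 1 := sub_pos

theorem continuousOn_inverseScale {H : ℝ → ℝ} {τ₁ : ℝ} (hτ₁ : p.τ₀ ≤ τ₁)
    (hH : IntegrableOn H (Icc p.τ₀ τ₁)) : ContinuousOn (p.inverseScale H) (Icc p.τ₀ τ₁) := by
  rw [← uIcc_of_le hτ₁] at hH ⊢
  exact continuousOn_const.sub
    (continuousOn_const.mul (intervalIntegral.continuousOn_primitive_interval hH))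

theorem integral_congr_Icc {F G : ℝ → ℝ} {a b τ : ℝ} (h : EqOn F G (Icc a b)) (hτ : τ ∈ Icc a b) :
    ∫ η in a..τ, F η = ∫ η in a..τ, G η := by
  refine intervalIntegral.integral_congr fun η hη => ?_
  rw [uIcc_of_le hτ.1] at hη
  exact h ⟨hη.1, hη.2.trans hτ.2⟩

theorem IsRegularOn.mono {H : ℝ → ℝ} {τ₁ τ₂ : ℝ} (h : p.IsRegularOn H τ₂) (hle : τ₁ ≤ τ₂) :
    p.IsRegularOn H τ₁ where
  continuousOn := h.continuousOn.mono (Icc_subset_Icc_right hle)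
  equation τ hτ := h.equation τ (Icc_subset_Icc_right hle hτ)
  abs_lt τ hτ := h.abs_lt τ (Icc_subset_Icc_right hle hτ)
  integral_lt τ hτ := h.integral_lt τ (Icc_subset_Icc_right hle hτ)

theorem IsRegularOn.congr {H H' : ℝ → ℝ} {τ₁ : ℝ} (h : p.IsRegularOn H τ₁)
    (he : EqOn H' H (Icc p.τ₀ τ₁)) : p.IsRegularOn H' τ₁ where
  continuousOn := h.continuousOn.congr he
  equation τ hτ := by
    rw [he hτ, h.equation τ hτ, integral_congr_Icc (rhs_congr he) hτ]
  abs_lt τ hτ := by rw [he hτ]; exact h.abs_lt τ hτ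
  integral_lt τ hτ := by rw [integral_congr_Icc he hτ]; exact h.integral_lt τ hτ

/-- The degenerate interval starts the construction; `IsRegularOn.exists_extension` then gives local
existence. -/
theorem isRegularOn_τ₀ (hH₀ : |p.H₀| < p.Hc) : p.IsRegularOn (fun _ => p.H₀) p.τ₀ where
  continuousOn := continuousOn_const
  equation τ hτ := by
    rw [Icc_self] at hτ
    rw [hτ]
    simp
  abs_lt τ _ := hH₀
  integral_lt τ hτ := by
    rw [Icc_self] at hτ
    rw [hτ]
    simp

/-- A regular solution on a compact interval keeps away from the boundary of the domain. -/
theorem IsRegularOn.exists_bounds {H : ℝ → ℝ} {τ₁ : ℝ} (h : p.IsRegularOn H τ₁)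
    (hτ₁ : p.τ₀ ≤ τ₁) : ∃ b δ, 0 ≤ b ∧ b < p.Hc ∧ 0 < δ ∧ (∀ τ ∈ Icc p.τ₀ τ₁, |H τ| ≤ b) ∧
      ∀ τ ∈ Icc p.τ₀ τ₁, δ ≤ p.inverseScale H τ := by
  have hne : (Icc p.τ₀ τ₁).Nonempty := nonempty_Icc.2 hτ₁
  obtain ⟨x, hx, hmax⟩ := isCompact_Icc.exists_isMaxOn hne h.continuousOn.abs
  obtain ⟨y, hy, hmin⟩ := isCompact_Icc.exists_isMinOn hne (continuousOn_inverseScale hτ₁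
    (h.continuousOn.integrableOn_compact isCompact_Icc))
  exact ⟨|H x|, p.inverseScale H y, abs_nonneg _, h.abs_lt x hx,
    inverseScale_pos_iff.2 (h.integral_lt y hy), fun τ hτ => hmax hτ, fun τ hτ => hmin hτ⟩

theorem rhs_eqOn_cutRhs (ha₀ : 0 < p.a₀) {b δ : ℝ} (hδ0 : 0 < δ) {G H : ℝ → ℝ} (hG : Continuous G)
    {τ₁ : ℝ} (he : EqOn G H (Icc p.τ₀ τ₁)) (hb : ∀ τ ∈ Icc p.τ₀ τ₁, |H τ| ≤ b)
    (hδ : ∀ τ ∈ Icc p.τ₀ τ₁, δ ≤ p.inverseScale H τ) :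
    EqOn (p.rhs H) (p.cutRhs b δ G) (Icc p.τ₀ τ₁) := by
  refine (rhs_congr he.symm).trans (rhs_eq_cutRhs ha₀ hδ0 hG (fun τ hτ => ?_) fun τ hτ => ?_)
  · rw [he hτ]; exact hb τ hτ
  · rw [inverseScale_congr he hτ]; exact hδ τ hτ

theorem IsRegularOn.cut_equation (ha₀ : 0 < p.a₀) {b δ : ℝ} (hδ0 : 0 < δ) {G H : ℝ → ℝ}
    (hG : Continuous G) {τ₁ : ℝ} (h : p.IsRegularOn H τ₁) (he : EqOn G H (Icc p.τ₀ τ₁))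
    (hb : ∀ τ ∈ Icc p.τ₀ τ₁, |H τ| ≤ b) (hδ : ∀ τ ∈ Icc p.τ₀ τ₁, δ ≤ p.inverseScale H τ) :
    ∀ τ ∈ Icc p.τ₀ τ₁, G τ = p.H₀ + ∫ η in p.τ₀..τ, p.cutRhs b δ G η := fun τ hτ => by
  rw [he hτ, h.equation τ hτ, integral_congr_Icc (rhs_eqOn_cutRhs ha₀ hδ0 hG he hb hδ) hτ]

theorem isRegularOn_of_cut_equation (ha₀ : 0 < p.a₀) {b δ : ℝ} (hbc : b < p.Hc) (hδ0 : 0 < δ)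
    {G : ℝ → ℝ} (hG : Continuous G) {τ₁ : ℝ}
    (h : ∀ τ ∈ Icc p.τ₀ τ₁, G τ = p.H₀ + ∫ η in p.τ₀..τ, p.cutRhs b δ G η)
    (hb : ∀ τ ∈ Icc p.τ₀ τ₁, |G τ| ≤ b) (hδ : ∀ τ ∈ Icc p.τ₀ τ₁, δ ≤ p.inverseScale G τ) :
    p.IsRegularOn G τ₁ where
  continuousOn := hG.continuousOn
  equation τ hτ := by
    rw [integral_congr_Icc (rhs_eqOn_cutRhs ha₀ hδ0 hG (fun _ _ => rfl) hb hδ) hτ]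
    exact h τ hτ
  abs_lt τ hτ := (hb τ hτ).trans_lt hbc
  integral_lt τ hτ := inverseScale_pos_iff.1 (hδ0.trans_le (hδ τ hτ))

theorem IsRegularOn.eqOn_cut_solution (hm : 0 < p.m) (ha₀ : 0 < p.a₀) {b δ : ℝ} (hb0 : 0 ≤ b)
    (hbc : b < p.Hc) (hδ0 : 0 < δ) {G H : ℝ → ℝ} (hG : Continuous G) {τ₁ : ℝ} (hτ₁ : p.τ₀ ≤ τ₁)
    (hGeq : ∀ τ ∈ Icc p.τ₀ τ₁, G τ = p.H₀ + ∫ η in p.τ₀..τ, p.cutRhs b δ G η)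
    (h : p.IsRegularOn H τ₁) (hb : ∀ τ ∈ Icc p.τ₀ τ₁, |H τ| ≤ b)
    (hδ : ∀ τ ∈ Icc p.τ₀ τ₁, δ ≤ p.inverseScale H τ) : EqOn G H (Icc p.τ₀ τ₁) := by
  obtain ⟨F, hF, hFH⟩ := h.continuousOn.exists_continuous_eqOn_Icc hτ₁
  obtain ⟨B, K, hΦ⟩ := exists_isCausalLipschitz_cutRhs hm ha₀ hb0 hbc hδ0 hτ₁
  exact (hΦ.eqOn hG hF (right_mem_Icc.2 hτ₁) hGeq
    (h.cut_equation ha₀ hδ0 hF hFH hb hδ)).trans hFH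

/-- By compactness both solutions stay inside one common truncation, whose equation has a unique
solution. -/
theorem IsRegularOn.eqOn (hm : 0 < p.m) (ha₀ : 0 < p.a₀) {H H' : ℝ → ℝ} {τ₁ : ℝ}
    (hτ₁ : p.τ₀ ≤ τ₁) (h : p.IsRegularOn H τ₁) (h' : p.IsRegularOn H' τ₁) :
    EqOn H H' (Icc p.τ₀ τ₁) := by
  obtain ⟨b, δ, hb0, hbc, hδ0, hb, hδ⟩ := h.exists_bounds hτ₁
  obtain ⟨b', δ', -, hbc', hδ0', hb', hδ'⟩ := h'.exists_bounds hτ₁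
  have hB : max b b' < p.Hc := max_lt hbc hbc'
  have hD : 0 < min δ δ' := lt_min hδ0 hδ0'
  obtain ⟨F, hF, hFH⟩ := h.continuousOn.exists_continuous_eqOn_Icc hτ₁
  have hFeq := h.cut_equation ha₀ hD hF hFH (fun τ hτ => (hb τ hτ).trans (le_max_left b b'))
    fun τ hτ => (min_le_left δ δ').trans (hδ τ hτ)
  exact hFH.symm.trans (h'.eqOn_cut_solution hm ha₀ (hb0.trans (le_max_left _ _)) hB hD hF hτ₁ hFeq
    (fun τ hτ => (hb' τ hτ).trans (le_max_right _ _))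
    fun τ hτ => (min_le_right _ _).trans (hδ' τ hτ))

theorem exists_cut_solution (hm : 0 < p.m) (ha₀ : 0 < p.a₀) {b δ : ℝ} (hb0 : 0 ≤ b)
    (hbc : b < p.Hc) (hδ0 : 0 < δ) {τ₁ : ℝ} (hτ₁ : p.τ₀ ≤ τ₁) : ∃ G : ℝ → ℝ, Continuous G ∧
      ∀ τ ∈ Icc p.τ₀ τ₁, G τ = p.H₀ + ∫ η in p.τ₀..τ, p.cutRhs b δ G η := by
  obtain ⟨B, K, hΦ⟩ := exists_isCausalLipschitz_cutRhs hm ha₀ hb0 hbc hδ0 hτ₁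
  exact hΦ.exists_solution hτ₁ p.H₀

theorem continuous_inverseScale {G : ℝ → ℝ} (hG : Continuous G) :
    Continuous (p.inverseScale G) :=
  continuous_const.sub (continuous_const.mul (continuous_primitive p.τ₀ hG))

/-- The equation has memory, so it is not restarted at `τ₁`. Instead a truncated equation with some
slack is solved from `τ₀` on a longer interval; its solution agrees with H up to `τ₁`, and by
continuity the truncation stays inactive a little longer. -/
theorem IsRegularOn.exists_extension (hm : 0 < p.m) (ha₀ : 0 < p.a₀) {H : ℝ → ℝ} {τ₁ : ℝ}
    (hτ₁ : p.τ₀ ≤ τ₁) (h : p.IsRegularOn H τ₁) : ∃ τ₂, τ₁ < τ₂ ∧ ∃ G, p.IsRegularOn G τ₂ := by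
  obtain ⟨b, δ, hb0, hbc, hδ0, hb, hδ⟩ := h.exists_bounds hτ₁
  have hb1 : b < (b + p.Hc) / 2 := by linarith
  have hb2 : (b + p.Hc) / 2 < p.Hc := by linarith
  have hδ1 : δ / 2 < δ := by linarith
  have hδ2 : 0 < δ / 2 := by linarith
  obtain ⟨G, hG, hGeq⟩ := exists_cut_solution (p := p) hm ha₀ (hb0.trans hb1.le) hb2 hδ2
    (show p.τ₀ ≤ τ₁ + 1 by linarith)
  have hGH : EqOn G H (Icc p.τ₀ τ₁) := h.eqOn_cut_solution hm ha₀ (hb0.trans hb1.le) hb2 hδ2 hG hτ₁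
    (fun τ hτ => hGeq τ ⟨hτ.1, by linarith [hτ.2]⟩) (fun τ hτ => (hb τ hτ).trans hb1.le)
    fun τ hτ => hδ1.le.trans (hδ τ hτ)
  have hr : τ₁ ∈ Icc p.τ₀ τ₁ := right_mem_Icc.2 hτ₁
  have hev : ∀ᶠ τ in 𝓝 τ₁, |G τ| < (b + p.Hc) / 2 ∧ δ / 2 < p.inverseScale G τ := by
    refine (hG.abs.continuousAt.eventually (gt_mem_nhds ?_)).and
      ((continuous_inverseScale hG).continuousAt.eventually (lt_mem_nhds ?_))
    · change |G τ₁| < _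
      rw [hGH hr]; exact (hb _ hr).trans_lt hb1
    · rw [inverseScale_congr hGH hr]; exact hδ1.trans_le (hδ _ hr)
  obtain ⟨ε, hε, hball⟩ := Metric.eventually_nhds_iff.1 hev
  set s := min (ε / 2) 1 with hs
  have hs0 : 0 < s := by positivity
  have hs1 : s ≤ ε / 2 := min_le_left _ _
  have hs2 : s ≤ 1 := min_le_right _ _
  have hmem : ∀ τ ∈ Icc p.τ₀ (τ₁ + s), |G τ| ≤ (b + p.Hc) / 2 ∧ δ / 2 ≤ p.inverseScale G τ := by
    intro τ hτ
    rcases le_total τ τ₁ with hle | hle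
    · have hτ' : τ ∈ Icc p.τ₀ τ₁ := ⟨hτ.1, hle⟩
      rw [hGH hτ', inverseScale_congr hGH hτ']
      exact ⟨(hb τ hτ').trans hb1.le, hδ1.le.trans (hδ τ hτ')⟩
    · have := hball (y := τ) (by
        rw [Real.dist_eq, abs_of_nonneg (by linarith)]; linarith [hτ.2])
      exact ⟨this.1.le, this.2.le⟩
  refine ⟨τ₁ + s, by linarith, G, isRegularOn_of_cut_equation ha₀ hb2 hδ2 hG
    (fun τ hτ => hGeq τ ⟨hτ.1, by linarith [hτ.2]⟩) (fun τ hτ => (hmem τ hτ).1)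
    fun τ hτ => (hmem τ hτ).2⟩

theorem IsRegularOn.convergesAt (hm : 0 < p.m) (ha₀ : 0 < p.a₀) {H : ℝ → ℝ} {τ : ℝ}
    (hτ : p.τ₀ ≤ τ) (h : p.IsRegularOn H τ) : p.ConvergesAt H τ := by
  obtain ⟨b, δ, hb0, hbc, hδ0, hb, hδ⟩ := h.exists_bounds hτ
  obtain ⟨F, hF, hFH⟩ := h.continuousOn.exists_continuous_eqOn_Icc hτ
  have hr : τ ∈ Icc p.τ₀ τ := right_mem_Icc.2 hτ
  have hμ : 0 < p.a₀ * p.m := mul_pos ha₀ hm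
  have hv := continuous_cutRate (p := p) b hδ0 hF
  have hpot : EqOn (p.potential H) (primitive p.τ₀ (p.cutRate b δ F)) (Icc p.τ₀ τ) := by
    refine (potential_congr hFH.symm).trans
      (potential_eq_primitive_cutRate hδ0 hF (fun τ hτ => ?_) fun τ hτ => ?_)
    · rw [hFH hτ]; exact hb τ hτ
    · rw [inverseScale_congr hFH hτ]; exact hδ τ hτ
  refine ⟨fun k => ?_, ?_, ?_⟩
  · simp only [partialMode_eq hpot _ _ hr]
    exact summable_dysonTerm (by rw [freq_eq]; exact dispersion_pos hμ k) _
      (continuous_primitive _ hv) τ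
  · rw [wickIntegrand_eq hpot hr]
    exact integrable_wickDensity hμ hτ hv
  · obtain ⟨B, K, hΦ⟩ := exists_isCausalLipschitz_cutRhs hm ha₀ hb0 hbc hδ0 hτ
    refine (intervalIntegrable_iff_integrableOn_Icc_of_le hτ).2
      ((hΦ.integrableOn hF).congr_fun (fun η hη => ?_) measurableSet_Icc)
    exact (rhs_eqOn_cutRhs ha₀ hδ0 hF hFH hb hδ hη).symm

/-! ### Behaviour at a finite end point -/

/-- If `f(H)` is bounded by `B` where `|H| ≤ h₁`, a regular solution that starts at level `h` does
not leave `|H| < h₁` before the time `(h₁ - h) / B`. -/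
theorem abs_lt_of_rhs_bound {H : ℝ → ℝ} {s t h h₁ B : ℝ} (hs : p.τ₀ ≤ s)
    (hreg : ∀ r ∈ Ico s t, p.IsRegularOn H r)
    (hint : ∀ r ∈ Ico s t, IntervalIntegrable (p.rhs H) volume p.τ₀ r)
    (hB0 : 0 ≤ B) (hB : ∀ r ∈ Ico s t, |H r| ≤ h₁ → |p.rhs H r| ≤ B)
    (hHs : |H s| ≤ h) (hlt : h + B * (t - s) < h₁) : ∀ r ∈ Ico s t, |H r| < h₁ := by
  intro r hr
  by_contra! hcon
  have hh : h < h₁ := by nlinarith [hr.1, hr.2]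
  have hc : ContinuousOn (fun x => |H x|) (Icc s r) :=
    ((hreg r hr).continuousOn.mono (Icc_subset_Icc_left hs)).abs
  -- The least element of `A` is the first time at which |H| reaches `h₁`; up to then the slope is
  -- at most `B`.
  set A := Icc s r ∩ (fun x => |H x|) ⁻¹' {h₁} with hA
  have hAne : A.Nonempty := by
    obtain ⟨x, hx, hxe⟩ := intermediate_value_Icc hr.1 hc ⟨hHs.trans hh.le, hcon⟩
    exact ⟨x, hx, hxe⟩
  have hAc : IsCompact A :=
    isCompact_Icc.of_isClosed_subset (hc.preimage_isClosed_of_isClosed isClosed_Icc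
      isClosed_singleton) inter_subset_left
  obtain ⟨x, ⟨hx, hxe⟩, hleast⟩ := hAc.exists_isLeast hAne
  have hxe' : |H x| = h₁ := hxe
  have hle : ∀ y ∈ Icc s x, |H y| ≤ h₁ := by
    intro y hy
    by_contra! hy1
    obtain ⟨z, hz, hze⟩ := intermediate_value_Icc hy.1
      (hc.mono (Icc_subset_Icc_right (hy.2.trans hx.2))) ⟨hHs.trans hh.le, hy1.le⟩
    have hze' : |H z| = h₁ := hze
    have h1 : x ≤ z := hleast ⟨⟨hz.1, hz.2.trans (hy.2.trans hx.2)⟩, hze⟩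
    have h2 : y = x := le_antisymm hy.2 (h1.trans hz.2)
    rw [h2, hxe'] at hy1
    exact lt_irrefl _ hy1
  have hxt : x ∈ Ico s t := ⟨hx.1, hx.2.trans_lt hr.2⟩
  have hst : s ∈ Ico s t := ⟨le_rfl, hx.1.trans_lt hxt.2⟩
  have hdiff : H x - H s = ∫ η in s..x, p.rhs H η := by
    rw [(hreg x hxt).equation x ⟨hs.trans hx.1, le_rfl⟩, (hreg s hst).equation s ⟨hs, le_rfl⟩,
      add_sub_add_left_eq_sub, intervalIntegral.integral_interval_sub_left (hint x hxt)
      (hint s hst)]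
  have hbd : |H x - H s| ≤ B * (x - s) := by
    rw [hdiff]
    exact abs_primitive_le hx.1 fun η hη => hB η ⟨hη.1, hη.2.trans_lt hxt.2⟩ (hle η hη)
  have h3 : |H x| ≤ |H s| + |H x - H s| := by
    have := abs_add_le (H s) (H x - H s)
    rwa [add_sub_cancel] at this
  have h4 : B * (x - s) ≤ B * (t - s) := by
    have : x ≤ t := hxt.2.le
    gcongr
  linarith

/-- A regular solution on `[τ₀, t)` along which `a(H)` stays bounded and `H ^ 2` does not tend to
`H_c ^ 2` keeps `|H|` away from `H_c`. -/
theorem exists_abs_le_of_not_tendsto (hm : 0 < p.m) (ha₀ : 0 < p.a₀) {H : ℝ → ℝ} {t δ : ℝ}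
    (hHc : 0 < p.Hc) (ht : p.τ₀ < t) (hreg : ∀ r ∈ Ico p.τ₀ t, p.IsRegularOn H r) (hδ0 : 0 < δ)
    (hδ : ∀ r ∈ Ico p.τ₀ t, δ ≤ p.inverseScale H r)
    (hlim : ¬ Tendsto (fun τ => H τ ^ 2) (𝓝[<] t) (𝓝 (p.Hc ^ 2))) :
    ∃ b, 0 ≤ b ∧ b < p.Hc ∧ ∀ r ∈ Ico p.τ₀ t, |H r| ≤ b := by
  have hIco : ∀ᶠ s in 𝓝[<] t, s ∈ Ico p.τ₀ t := Ico_mem_nhdsLT ht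
  obtain ⟨ε, hε, hfreq⟩ : ∃ ε > 0, ∃ᶠ s in 𝓝[<] t, ε ≤ |H s ^ 2 - p.Hc ^ 2| := by
    simpa [Metric.tendsto_nhds, Real.dist_eq] using hlim
  -- The minimum keeps the radicand nonnegative when ε exceeds H_c².
  set h := √(p.Hc ^ 2 - min ε (p.Hc ^ 2)) with hh
  have hmin : 0 < min ε (p.Hc ^ 2) := by positivity
  have hnn : 0 ≤ p.Hc ^ 2 - min ε (p.Hc ^ 2) := sub_nonneg.2 (min_le_right _ _)
  have hhc : h < p.Hc := (Real.sqrt_lt' hHc).2 (by linarith)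
  set h₁ := (h + p.Hc) / 2 with hh₁
  have hh1 : h < h₁ := by linarith
  have hh2 : h₁ < p.Hc := by linarith
  obtain ⟨B, hB⟩ := exists_rhs_bound hm ha₀ hh2 hδ0 (sub_nonneg.2 ht.le)
  have hBH : ∀ r ∈ Ico p.τ₀ t, |H r| ≤ h₁ → |p.rhs H r| ≤ |B| := by
    intro r hr hrh
    obtain ⟨F, hF, hFH⟩ := (hreg r hr).continuousOn.exists_continuous_eqOn_Icc hr.1
    have hrr : r ∈ Icc p.τ₀ r := right_mem_Icc.2 hr.1
    rw [← rhs_congr hFH hrr]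
    refine (hB F hF r hr.1 (by linarith [hr.2]) (fun η hη => ?_) (fun η hη => ?_) ?_).trans
      (le_abs_self B)
    · rw [hFH hη]; exact ((hreg r hr).abs_lt η hη).le
    · rw [inverseScale_congr hFH hη]; exact hδ η ⟨hη.1, hη.2.trans_lt hr.2⟩
    · rw [hFH hrr]; exact hrh
  have hclose : ∀ᶠ s in 𝓝[<] t, h + |B| * (t - s) < h₁ := by
    have hc : ContinuousAt (fun s => h + |B| * (t - s)) t := by fun_prop
    exact (hc.eventually (gt_mem_nhds (by simpa using hh1))).filter_mono nhdsWithin_le_nhds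
  -- A time at which |H| ≤ h, so close to `t` that slope `|B|` cannot raise |H| to `h₁` before `t`.
  -- Earlier times are covered by compactness.
  obtain ⟨s, hsε, hs, hsc⟩ := (hfreq.and_eventually (hIco.and hclose)).exists
  have hHs : |H s| ≤ h := by
    have h1 := (hreg s hs).abs_lt s (right_mem_Icc.2 hs.1)
    have h2 : H s ^ 2 < p.Hc ^ 2 := sq_lt_sq.2 (by rwa [abs_of_pos hHc])
    rw [abs_of_neg (by linarith)] at hsε
    refine Real.abs_le_sqrt ?_
    linarith [min_le_left ε (p.Hc ^ 2)]
  have hlt := abs_lt_of_rhs_bound hs.1 (fun r hr => hreg r ⟨hs.1.trans hr.1, hr.2⟩)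
    (fun r hr => ((hreg r ⟨hs.1.trans hr.1, hr.2⟩).convergesAt hm ha₀
      (hs.1.trans hr.1)).integrable_rhs) (abs_nonneg B)
    (fun r hr => hBH r ⟨hs.1.trans hr.1, hr.2⟩) hHs hsc
  obtain ⟨b, -, hb0, hbc, -, hb, -⟩ := (hreg s hs).exists_bounds hs.1
  refine ⟨max b h₁, hb0.trans (le_max_left _ _), max_lt hbc hh2, fun r hr => ?_⟩
  rcases le_total r s with hrs | hrs
  · exact (hb r ⟨hr.1, hrs⟩).trans (le_max_left _ _)
  · exact (hlt r ⟨hrs, hr.2⟩).le.trans (le_max_right _ _)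

/-- A regular solution on `[τ₀, t)` that stays away from the boundary of the domain extends
to `t`. -/
theorem exists_isRegularOn_endpoint (hm : 0 < p.m) (ha₀ : 0 < p.a₀) {H : ℝ → ℝ} {t b δ : ℝ}
    (ht : p.τ₀ < t) (hreg : ∀ r ∈ Ico p.τ₀ t, p.IsRegularOn H r) (hb0 : 0 ≤ b) (hbc : b < p.Hc)
    (hb : ∀ r ∈ Ico p.τ₀ t, |H r| ≤ b) (hδ0 : 0 < δ)
    (hδ : ∀ r ∈ Ico p.τ₀ t, δ ≤ p.inverseScale H r) : ∃ G, p.IsRegularOn G t := by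
  -- The truncated solution exists on the closed interval and equals H before `t`; the two bounds
  -- pass to `t` by continuity.
  obtain ⟨G, hG, hGeq⟩ := exists_cut_solution (p := p) hm ha₀ hb0 hbc hδ0 ht.le
  have hGH : ∀ r ∈ Ico p.τ₀ t, EqOn G H (Icc p.τ₀ r) := fun r hr =>
    (hreg r hr).eqOn_cut_solution hm ha₀ hb0 hbc hδ0 hG hr.1
      (fun τ hτ => hGeq τ ⟨hτ.1, hτ.2.trans hr.2.le⟩)
      (fun τ hτ => hb τ ⟨hτ.1, hτ.2.trans_lt hr.2⟩) fun τ hτ => hδ τ ⟨hτ.1, hτ.2.trans_lt hr.2⟩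
  have hcl : closure (Ico p.τ₀ t) = Icc p.τ₀ t := closure_Ico ht.ne
  refine ⟨G, isRegularOn_of_cut_equation ha₀ hbc hδ0 hG hGeq (fun τ hτ => ?_) fun τ hτ => ?_⟩
  · refine le_on_closure (s := Ico p.τ₀ t) (f := fun τ => |G τ|) (g := fun _ => b)
      (fun r hr => ?_) hG.abs.continuousOn continuousOn_const (hcl ▸ hτ)
    change |G r| ≤ b
    rw [hGH r hr (right_mem_Icc.2 hr.1)]
    exact hb r hr
  · refine le_on_closure (s := Ico p.τ₀ t) (f := fun _ => δ) (g := p.inverseScale G)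
      (fun r hr => ?_) continuousOn_const (continuous_inverseScale hG).continuousOn (hcl ▸ hτ)
    rw [inverseScale_congr (hGH r hr) (right_mem_Icc.2 hr.1)]
    exact hδ r hr

/-- Since |H| < H_c, H is integrable up to `t` and a₀/a is continuous on the closed interval. Its
minimum is either positive or the value 0 attained at `t`. The value of H at `t` itself is
irrelevant to the integral. -/
theorem tendsto_scaleFactor_or_exists_le (ha₀ : 0 < p.a₀) {H : ℝ → ℝ} {t : ℝ}
    (ht : p.τ₀ < t) (hreg : ∀ r ∈ Ico p.τ₀ t, p.IsRegularOn H r) :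
    Tendsto (p.scaleFactor H) (𝓝[<] t) atTop ∨
      ∃ δ, 0 < δ ∧ ∀ r ∈ Ico p.τ₀ t, δ ≤ p.inverseScale H r := by
  have hc : ContinuousOn H (Ico p.τ₀ t) := fun r hr => by
    obtain ⟨s, hrs, hst⟩ := exists_between hr.2
    have h1 := (hreg s ⟨hr.1.trans hrs.le, hst⟩).continuousOn r ⟨hr.1, hrs.le⟩
    refine h1.mono_of_mem_nhdsWithin ?_
    filter_upwards [self_mem_nhdsWithin, mem_nhdsWithin_of_mem_nhds (Iic_mem_nhds hrs)] with x hx hx'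
    exact ⟨hx.1, hx'⟩
  have hint : IntegrableOn H (Icc p.τ₀ t) := by
    rw [integrableOn_Icc_iff_integrableOn_Ico]
    exact Integrable.of_bound (hc.aestronglyMeasurable measurableSet_Ico) p.Hc
      ((ae_restrict_iff' measurableSet_Ico).2 (.of_forall fun r hr => ((hreg r hr).abs_lt r (right_mem_Icc.2 hr.1)).le))
  have hq := continuousOn_inverseScale ht.le hint
  have hpos : ∀ r ∈ Ico p.τ₀ t, 0 < p.inverseScale H r := fun r hr =>
    inverseScale_pos_iff.2 ((hreg r hr).integral_lt r (right_mem_Icc.2 hr.1))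
  obtain ⟨x, hx, hmin⟩ := isCompact_Icc.exists_isMinOn (nonempty_Icc.2 ht.le) hq
  by_cases hx0 : 0 < p.inverseScale H x
  · exact Or.inr ⟨_, hx0, fun r hr => hmin (Ico_subset_Icc_self hr)⟩
  left
  have hxt : x = t := by
    by_contra hne
    exact hx0 (hpos x ⟨hx.1, lt_of_le_of_ne hx.2 hne⟩)
  rw [hxt] at hx0
  have hIco : Ico p.τ₀ t ∈ 𝓝[<] t := Ico_mem_nhdsLT ht
  have hlim : Tendsto (p.inverseScale H) (𝓝[<] t) (𝓝 (p.inverseScale H t)) :=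
    (hq t (right_mem_Icc.2 ht.le)).mono_left (nhdsWithin_le_of_mem
      (mem_of_superset hIco Ico_subset_Icc_self))
  have h0 : p.inverseScale H t = 0 := le_antisymm (not_lt.1 hx0)
    (ge_of_tendsto hlim (mem_of_superset hIco fun r hr => (hpos r hr).le))
  rw [h0] at hlim
  have hlim' : Tendsto (p.inverseScale H) (𝓝[<] t) (𝓝[>] 0) :=
    tendsto_nhdsWithin_iff.2 ⟨hlim, mem_of_superset hIco hpos⟩
  exact (tendsto_inv_nhdsGT_zero.comp hlim').const_mul_atTop ha₀

/-! ### The greatest solution and the main theorem -/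

theorem IsRegularSolution.eqOn (hm : 0 < p.m) (ha₀ : 0 < p.a₀) {T T' : EReal} {H H' : ℝ → ℝ}
    (h : p.IsRegularSolution T H) (h' : p.IsRegularSolution T' H') (hle : T' ≤ T) :
    EqOn H' H (p.interval T') := fun τ hτ =>
  (h'.2 τ hτ).eqOn hm ha₀ hτ.1 (h.2 τ ⟨hτ.1, hτ.2.trans_le hle⟩) (right_mem_Icc.2 hτ.1)

/-- There is a regular solution whose interval contains that of every other one. -/
theorem exists_greatest_solution (hm : 0 < p.m) (ha₀ : 0 < p.a₀) (hH₀ : |p.H₀| < p.Hc) :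
    ∃ (T : EReal) (H : ℝ → ℝ), p.IsRegularSolution T H ∧
      ∀ τ, p.τ₀ ≤ τ → ∀ G, p.IsRegularOn G τ → (τ : EReal) < T := by
  set S : Set ℝ := {t | p.τ₀ ≤ t ∧ ∃ H, p.IsRegularOn H t} with hS
  have hex : ∀ t, ∃ H, t ∈ S → p.IsRegularOn H t := fun t => by
    by_cases ht : t ∈ S
    · exact ht.2.imp fun H hH _ => hH
    · exact ⟨0, fun h => absurd h ht⟩
  choose G hG using hex
  -- By the extension property the supremum is not attained, so the greatest interval is half-open.
  set T : EReal := sSup ((fun t : ℝ => (t : EReal)) '' S) with hT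
  have hlt : ∀ τ ∈ S, (τ : EReal) < T := fun τ hτ => by
    obtain ⟨τ₂, h12, G', hG'⟩ := (hG τ hτ).exists_extension hm ha₀ hτ.1
    have h2 : τ₂ ∈ S := ⟨hτ.1.trans h12.le, G', hG'⟩
    exact (EReal.coe_lt_coe_iff.2 h12).trans_le (le_sSup ⟨τ₂, h2, rfl⟩)
  have hmem : ∀ τ ∈ p.interval T, τ ∈ S := fun τ hτ => by
    obtain ⟨_, ⟨s, hs, rfl⟩, hτs⟩ := lt_sSup_iff.1 hτ.2
    exact ⟨hτ.1, G s, (hG s hs).mono (EReal.coe_lt_coe_iff.1 hτs).le⟩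
  -- Gluing along the diagonal: at time t the solution chosen on [τ₀, t] is used, and uniqueness
  -- makes these values agree with any solution on a longer interval.
  refine ⟨T, fun t => G t t, ⟨hlt _ ⟨le_rfl, _, isRegularOn_τ₀ hH₀⟩, fun τ hτ => ?_⟩,
    fun τ hτ G hG => hlt τ ⟨hτ, G, hG⟩⟩
  refine (hG τ (hmem τ hτ)).congr fun s hs => ?_
  have hsS : s ∈ S := ⟨hs.1, G τ, (hG τ (hmem τ hτ)).mono hs.2⟩
  exact (hG s hsS).eqOn hm ha₀ hs.1 ((hG τ (hmem τ hτ)).mono hs.2) (right_mem_Icc.2 hs.1)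

end FriedmannData

end

theorem mainTheorem3 (p : FriedmannData) (hm : 0 < p.m) (hℓ : 0 < p.ℓ) (hG : 0 < p.G)
    (ha₀ : 0 < p.a₀) (hH₀ : |p.H₀| < p.Hc) :
    ∃ (T : EReal) (H : ℝ → ℝ),
      p.IsMaximalSolution T H ∧
      (∀ (T' : EReal) (H' : ℝ → ℝ), p.IsRegularSolution T' H' →
        T' ≤ T ∧ EqOn H' H (p.interval T')) ∧
      (∀ (T' : EReal) (H' : ℝ → ℝ), p.IsMaximalSolution T' H' →
        T' = T ∧ EqOn H' H (p.interval T)) ∧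
      (∀ τ ∈ p.interval T, p.ConvergesAt H τ) ∧
      (T = ⊤ ∨ ∃ t : ℝ, T = (t : EReal) ∧
        (Tendsto (fun τ => H τ ^ 2) (𝓝[<] t) (𝓝 (p.Hc ^ 2)) ∨
          Tendsto (p.scaleFactor H) (𝓝[<] t) atTop)) := by
  obtain ⟨T, H, hH, hgreatest⟩ := FriedmannData.exists_greatest_solution hm ha₀ hH₀
  have hle : ∀ (T' : EReal) (H' : ℝ → ℝ), p.IsRegularSolution T' H' → T' ≤ T := by
    intro T' H' h'
    refine EReal.ge_of_forall_gt_iff_ge.1 fun τ hτ => ?_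
    rcases le_total p.τ₀ τ with h | h
    · exact (hgreatest τ h H' (h'.2 τ ⟨h, hτ⟩)).le
    · exact (EReal.coe_le_coe_iff.2 h).trans hH.1.le
  have hall : ∀ (T' : EReal) (H' : ℝ → ℝ), p.IsRegularSolution T' H' →
      T' ≤ T ∧ EqOn H' H (p.interval T') := fun T' H' h' =>
    ⟨hle T' H' h', hH.eqOn hm ha₀ h' (hle T' H' h')⟩
  refine ⟨T, H, ⟨hH, fun T' H' h' hTT' _ => (hle T' H' h').antisymm hTT'⟩, hall,
    fun T' H' h' => ?_, fun τ hτ => (hH.2 τ hτ).convergesAt hm ha₀ hτ.1, ?_⟩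
  · obtain ⟨h1, h2⟩ := hall T' H' h'.1
    -- A maximal solution is a restriction of the greatest one, so maximality forces the intervals
    -- to coincide.
    have h3 : T' = T := (h'.2 T H hH h1 h2.symm).symm
    exact ⟨h3, h3 ▸ h2⟩
  · rcases eq_or_ne T ⊤ with hT | hT
    · exact Or.inl hT
    right
    lift T to ℝ using ⟨hT, (bot_le.trans_lt hH.1).ne'⟩ with t
    have ht : p.τ₀ < t := EReal.coe_lt_coe_iff.1 hH.1
    have hreg : ∀ r ∈ Ico p.τ₀ t, p.IsRegularOn H r := fun r hr =>
      hH.2 r ⟨hr.1, EReal.coe_lt_coe_iff.2 hr.2⟩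
    refine ⟨t, rfl, ?_⟩
    rcases FriedmannData.tendsto_scaleFactor_or_exists_le ha₀ ht hreg with h | ⟨δ, hδ0, hδ⟩
    · exact Or.inr h
    left
    -- Otherwise H continues to a regular solution on the closed interval [τ₀, t], whereas all such
    -- end points lie strictly below T = t.
    by_contra hlim
    obtain ⟨b, hb0, hbc, hb⟩ := FriedmannData.exists_abs_le_of_not_tendsto hm ha₀
      ((abs_nonneg _).trans_lt hH₀) ht hreg hδ0 hδ hlim
    obtain ⟨G, hG⟩ := FriedmannData.exists_isRegularOn_endpoint hm ha₀ ht hreg hb0 hbc hb hδ0 hδ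
    exact lt_irrefl _ (hgreatest t ht.le G hG)
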